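/- Let $(\mathbb X,\mathcal X)$ be a Borel space with a localising ring $\mathcal X_0\subset\mathcal X$: a ring of measurable sets such that $B\cap C\in\mathcal X_0$ for all $B\in\mathcal X_0$, $C\in\mathcal X$, and for which there is a sequence $B_n\in\mathcal X_0$, $n\in\mathbb N$, increasing to $\mathbb X$ such that each set in $\mathcal X_0$ has the form $C\cap B_n$ with $C\in\mathcal X$, $n\in\mathbb N$. Fix such a sequence $(B_n)$. Let $\mathbf N$ be the space of all measures on $\mathbb X$ that take values in $\{0,1,2,\dots\}$ on $\mathcal X_0$, with the smallest $\sigma$-field making $\mu\mapsto\mu(B)$ measurable for every $B\in\mathcal X$. Write $\mu_B:=\mu(\cdot\cap B)$ for the restriction of $\mu$ to $B$, and $x\in\mu$ if $\mu(\{x\})>0$. A generator is a measurable map $\partial:\mathbf N\to\mathbf N$ such that - (H1) $\partial\mu\le\mu$ for all $\mu\in\mathbf N$; - (H2) $\partial(\mu+\delta_x)=\partial\mu+\delta_x$ for all $\mu\in\mathbf N$ and $x\in\partial\mu$; - (H3) $\partial(\partial\mu+\mu')=\partial\mu$ for all $\mu,\mu'\in\mathbf N$ with $\mu'\le\mu-\partial\mu$;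 - (H4) if $\mu,\mu'\in\mathbf N$ satisfy $\mu'\le\mu$ and $\partial\mu=\partial\mu'$, then $\partial(\mu+\psi)=\partial(\mu'+\psi)$ for all $\psi\in\mathbf N$. Its hull operator is $[\mu]:=\{x\in\mathbb X:\partial(\mu+\delta_x)=\partial\mu\}$. For a measure $\nu$ on $\mathbb X$ that is finite on $\mathcal X_0$, let $\Pi_\nu$ be the distribution on $\mathbf N$ of a Poisson process with intensity measure $\nu$. **Proposition 3.3.** Let $\partial$ be a generator, let $\lambda$ be a measure on $\mathbb X$ that is finite on $\mathcal X_0$, and let $\eta$ be a Poisson process on $\mathbb X$ with intensity measure $\lambda$, defined on a probability space $(\Omega,\mathcal F,\mathbb P)$. Assume that for each $B\in\{B_m:m\in\mathbb N\}$ $$\lim_{n\to\infty}\mathbb P\big((\partial\eta_{B_n})_B=(\partial\eta)_B,\ \eta_{[\eta_{B_n}]\cap B}=\eta_{[\eta]\cap B}\big)=1,\qquad(3.3)$$ $$\lim_{n\to\infty}\mathbb E\int\mathbf 1\big\{\mu_{[\eta]\cap B}=\mu_{[\eta_{B_n}]\cap B}\big\}\,\Pi_\lambda(d\mu)=1.\qquad(3.4)$$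 Then, for every measurable $A\subset\mathbf N$, $$\mathbb P\big(\eta_{[\eta]}\in A\mid\partial\eta\big)=\Pi_{\lambda_{[\eta]}}(A)\quad\mathbb P\text{-a.s.}$$ -/

import Mathlib

open MeasureTheory ProbabilityTheory Filter Topology
open scoped ENNReal

noncomputable section

/-- `B` is a localising sequence for the family `S` of measurable sets: it consists of members
of `S`, increases to the whole space, and each member of `S` has the form `C ∩ B n` for some
measurable `C` and some `n`. -/
structure IsLocalisingSeq {X : Type*} [MeasurableSpace X] (S : Set (Set X)) (B : ℕ → Set X) :
    Prop where
  mem : ∀ n, B n ∈ S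
  mono : Monotone B
  iUnion_eq : ⋃ n, B n = Set.univ
  exists_eq_inter : ∀ A ∈ S, ∃ C, MeasurableSet C ∧ ∃ n, A = C ∩ B n

/-- A localising ring of measurable subsets of `X`. -/
structure LocalisingRing (X : Type*) [MeasurableSpace X] where
  sets : Set (Set X)
  isSetRing : IsSetRing sets
  measurableSet : ∀ A ∈ sets, MeasurableSet A
  inter_mem : ∀ A ∈ sets, ∀ C, MeasurableSet C → A ∩ C ∈ sets
  exists_seq : ∃ B : ℕ → Set X, IsLocalisingSeq sets B

/-- The space `𝐍` of all measures on `X` that are integer-valued (in particular finite) on the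
localising ring. It is closed under addition. Its σ-algebra is the trace of the σ-algebra of
`Measure X`, that is, the smallest one making all maps `μ ↦ μ A`, `A` measurable, measurable. -/
def pointMeasures {X : Type*} [MeasurableSpace X] (R : LocalisingRing X) :
    AddSubmonoid (Measure X) where
  carrier := {μ | ∀ A ∈ R.sets, ∃ k : ℕ, μ A = k}
  zero_mem' := fun _ _ => ⟨0, by simp⟩
  add_mem' := by
    intro μ ν hμ hν A hA
    obtain ⟨k, hk⟩ := hμ A hA
    obtain ⟨l, hl⟩ := hν A hA
    exact ⟨k + l, by simp [hk, hl]⟩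

namespace PointMeasure

variable {X : Type*} [MeasurableSpace X] {R : LocalisingRing X}

/-- The Dirac measure `δ_x` as an element of `𝐍`. -/
def dirac (R : LocalisingRing X) (x : X) : pointMeasures R :=
  ⟨Measure.dirac x, by
    intro A hA
    rw [Measure.dirac_apply' x (R.measurableSet A hA)]
    by_cases hx : x ∈ A
    · exact ⟨1, by simp [hx]⟩
    · exact ⟨0, by simp [hx]⟩⟩

/-- The restriction `μ_S = μ(· ∩ S)` of `μ ∈ 𝐍` to a set `S`, as an element of `𝐍`. -/
def restrict (μ : pointMeasures R) (S : Set X) : pointMeasures R :=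
  ⟨(μ : Measure X).restrict S, by
    intro A hA
    have hAm := R.measurableSet A hA
    obtain ⟨k, hk⟩ := μ.2 _ (R.inter_mem A hA _
      (measurableSet_toMeasurable (μ : Measure X) (A ∩ S)))
    refine ⟨k, ?_⟩
    rw [Measure.restrict_apply hAm, ← hk]
    refine le_antisymm (measure_mono fun x hx => ⟨hx.1, subset_toMeasurable _ _ hx⟩) ?_
    calc (μ : Measure X) (A ∩ toMeasurable (μ : Measure X) (A ∩ S))
        ≤ (μ : Measure X) (toMeasurable (μ : Measure X) (A ∩ S)) :=
          measure_mono Set.inter_subset_right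
      _ = (μ : Measure X) (A ∩ S) := measure_toMeasurable _⟩

end PointMeasure

/-- A generator: a measurable map `∂ : 𝐍 → 𝐍` with the thinning, additivity, idempotency and
consistency properties. In the third property, `∂ μ + μ' ≤ μ` says that `μ' ≤ μ - ∂ μ`. -/
structure IsGenerator {X : Type*} [MeasurableSpace X] {R : LocalisingRing X}
    (del : pointMeasures R → pointMeasures R) : Prop where
  measurable : Measurable del
  thinning : ∀ μ, (del μ : Measure X) ≤ (μ : Measure X)
  additivity : ∀ μ x, 0 < (del μ : Measure X) {x} →
    del (μ + PointMeasure.dirac R x) = del μ + PointMeasure.dirac R x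
  idempotency : ∀ μ μ', ((del μ + μ' : pointMeasures R) : Measure X) ≤ (μ : Measure X) →
    del (del μ + μ') = del μ
  consistency : ∀ μ μ' : pointMeasures R, (μ' : Measure X) ≤ (μ : Measure X) →
    del μ = del μ' → ∀ ψ, del (μ + ψ) = del (μ' + ψ)

/-- The hull `[μ] = {x | ∂(μ + δ_x) = ∂ μ}`. -/
def generatorHull {X : Type*} [MeasurableSpace X] {R : LocalisingRing X}
    (del : pointMeasures R → pointMeasures R) (μ : pointMeasures R) : Set X :=
  {x | del (μ + PointMeasure.dirac R x) = del μ}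

/-- The Poisson distribution with parameter `t ∈ [0, ∞]`, as a measure on `[0, ∞]`; the
parameter `∞` gives the unit mass at `∞`. -/
def extendedPoisson (t : ℝ≥0∞) : Measure ℝ≥0∞ :=
  if t = ∞ then Measure.dirac ∞
  else (poissonMeasure t.toNNReal).map (fun k : ℕ => (k : ℝ≥0∞))

/-- `Q` is the distribution of a Poisson process with intensity measure `ν`: the number of
points in a measurable set `A` has the Poisson distribution with parameter `ν A`, and the
numbers of points in finitely many pairwise disjoint measurable sets are independent. -/
structure IsPoissonLaw {X : Type*} [MeasurableSpace X] {R : LocalisingRing X}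
    (ν : Measure X) (Q : Measure (pointMeasures R)) : Prop where
  isProbabilityMeasure : IsProbabilityMeasure Q
  map_eq : ∀ A, MeasurableSet A →
    Q.map (fun μ : pointMeasures R => (μ : Measure X) A) = extendedPoisson (ν A)
  indep : ∀ (m : ℕ) (A : Fin m → Set X), (∀ i, MeasurableSet (A i)) →
    Pairwise (fun i j => Disjoint (A i) (A j)) →
    iIndepFun (fun (i : Fin m) (μ : pointMeasures R) => (μ : Measure X) (A i)) Q

open Classical in
/-- `Π_ν`: the (unique) distribution on `𝐍` of a Poisson process with locally finite intensity
measure `ν`. -/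
def poissonLaw {X : Type*} [MeasurableSpace X] (R : LocalisingRing X) (ν : Measure X) :
    Measure (pointMeasures R) :=
  if h : ∃ Q : Measure (pointMeasures R), IsPoissonLaw ν Q then h.choose else 0

/-- `η` is a Poisson process on `X` with intensity measure `ν`. -/
structure IsPoissonProcess {X Ω : Type*} [MeasurableSpace X] [MeasurableSpace Ω]
    {R : LocalisingRing X} (η : Ω → pointMeasures R) (ν : Measure X) (P : Measure Ω) :
    Prop where
  measurable : Measurable η
  law : IsPoissonLaw ν (P.map η)

end

/-! The claim is equivalent to an identity of joint laws: the pair `(∂η, η_[η])` has the law of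
`(∂η, η'_[η])`, where `η'` is an independent copy of `η`. Indeed `[∂μ] = [μ]` (`hull_del`), so the
hull is a function of `∂η`, and the restriction of a Poisson process to a fixed set `S` is Poisson
with intensity `λ_S` (`map_restrict`).

For finite `λ` the Poisson law is `exp(-λ X) ∑ λⁿ/n!` (`expMeasure_eq`). A finite configuration
splits in exactly one way into a part fixed by `∂` and a rest lying in the hull of that part
(`eq_filter_iff`); the two parts are `∂μ` and `μ_[μ]`. Summing over all splittings of `n` points
turns the exponential measure into its product with itself (`tsum_lintegral_sum_ofPoints_compl`).
So, given a fixed part `μ`, the rest is governed by the exponential of `λ` restricted to `[μ]`,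
which is a multiple of a Poisson law. The multiple depends on `μ` alone and is the same for the
independent copy.

For general `λ` this applies to `η` restricted to `B n`, where `λ` is finite. By the two limit
hypotheses, inside each `B m` the pairs built from `B n` coincide with the limiting pairs with
probability tending to one, so equality of laws passes to the limit
(`map_eq_of_tendsto_measure_ne`). The restrictions to the sets `B m` determine the joint law
(`prod_ext_of_restrict`). -/

/-! ### Localising sequences and measurability on the space of point measures. -/

namespace LocalisingRing

variable {X : Type*} [MeasurableSpace X] (R : LocalisingRing X)

/-- A chosen localising sequence. -/
noncomputable def seq : ℕ → Set X := R.exists_seq.choose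

theorem isLocalisingSeq_seq : IsLocalisingSeq R.sets R.seq := R.exists_seq.choose_spec

variable {R}

theorem mem_of_subset {A C : Set X} (hA : A ∈ R.sets) (hC : MeasurableSet C) (h : C ⊆ A) :
    C ∈ R.sets := by
  have := R.inter_mem A hA C hC
  rwa [Set.inter_eq_self_of_subset_right h] at this

theorem singleton_mem [MeasurableSingletonClass X] (x : X) : {x} ∈ R.sets := by
  have hx : x ∈ ⋃ n, R.seq n := by rw [R.isLocalisingSeq_seq.iUnion_eq]; trivial
  obtain ⟨n, hn⟩ := Set.mem_iUnion.1 hx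
  exact mem_of_subset (R.isLocalisingSeq_seq.mem n) (measurableSet_singleton x) (by simpa using hn)

end LocalisingRing

theorem IsLocalisingSeq.iUnion_inter {X : Type*} [MeasurableSpace X] {S : Set (Set X)}
    {B : ℕ → Set X} (hB : IsLocalisingSeq S B) (A : Set X) : ⋃ n, A ∩ B n = A := by
  rw [← Set.inter_iUnion, hB.iUnion_eq, Set.inter_univ]

theorem IsLocalisingSeq.measure_eq_iSup {X : Type*} [MeasurableSpace X] {S : Set (Set X)}
    {B : ℕ → Set X} (hB : IsLocalisingSeq S B) (μ : Measure X) (A : Set X) :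
    μ A = ⨆ n, μ (A ∩ B n) := by
  conv_lhs => rw [← hB.iUnion_inter A]
  exact Monotone.measure_iUnion fun _ _ h => Set.inter_subset_inter_right A (hB.mono h)

namespace PointMeasure

variable {X : Type*} [MeasurableSpace X] {R : LocalisingRing X}

theorem ext {μ ν : pointMeasures R}
    (h : ∀ A, MeasurableSet A → (μ : Measure X) A = (ν : Measure X) A) : μ = ν :=
  Subtype.ext (Measure.ext h)

theorem lt_top (μ : pointMeasures R) {A : Set X} (hA : A ∈ R.sets) : (μ : Measure X) A < ∞ := by
  obtain ⟨k, hk⟩ := μ.2 A hA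
  simp [hk]

theorem ext_of_seq {B : ℕ → Set X} (hB : IsLocalisingSeq R.sets B) {μ ν : pointMeasures R}
    (h : ∀ m, restrict μ (B m) = restrict ν (B m)) : μ = ν := by
  refine ext fun A hA => ?_
  rw [hB.measure_eq_iSup (μ : Measure X), hB.measure_eq_iSup (ν : Measure X)]
  refine iSup_congr fun n => ?_
  have := congrArg (fun ρ : pointMeasures R => (ρ : Measure X) A) (h n)
  simpa [restrict, Measure.restrict_apply hA] using this

theorem restrict_apply (μ : pointMeasures R) {A S : Set X} (hA : MeasurableSet A) :
    (restrict μ S : Measure X) A = (μ : Measure X) (A ∩ S) :=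
  Measure.restrict_apply hA

theorem restrict_restrict (μ : pointMeasures R) {S T : Set X} (hT : MeasurableSet T) :
    restrict (restrict μ S) T = restrict μ (S ∩ T) :=
  ext fun A hA => by
    rw [restrict_apply _ hA, restrict_apply _ (hA.inter hT), restrict_apply _ hA]
    congr 1
    ext; simp only [Set.mem_inter_iff]; tauto

theorem measurable_apply {A : Set X} (hA : MeasurableSet A) :
    Measurable fun μ : pointMeasures R => (μ : Measure X) A :=
  (Measure.measurable_coe hA).comp measurable_subtype_coe

theorem measurable_of_apply {β : Type*} [MeasurableSpace β] {f : β → pointMeasures R}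
    (h : ∀ A, MeasurableSet A → Measurable fun b => (f b : Measure X) A) : Measurable f :=
  Measurable.subtype_mk (p := fun μ => μ ∈ pointMeasures R)
    (h := fun b => (f b).2) (Measure.measurable_of_measurable_coe _ h)

instance : MeasurableAdd₂ (pointMeasures R) where
  measurable_add := measurable_of_apply fun A hA => by
    simp only [AddSubmonoid.coe_add, Measure.coe_add, Pi.add_apply]
    exact ((measurable_apply hA).comp measurable_fst).add
      ((measurable_apply hA).comp measurable_snd)

theorem measurable_dirac : Measurable (dirac R) :=
  measurable_of_apply fun _ hA => (Measure.measurable_coe hA).comp Measure.measurable_dirac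

/-- Restrictions to the localising sequence are finite, so countably many evaluations, on a
countable generating algebra, separate points. The hull is defined by an equation between values of
the generator, so its measurability rests on this. -/
theorem measurableEq [MeasurableSpace.CountablyGenerated X] : MeasurableEq (pointMeasures R) := by
  let C := generateSetAlgebra (MeasurableSpace.countableGeneratingSet X)
  have hCc : C.Countable :=
    countable_generateSetAlgebra MeasurableSpace.countable_countableGeneratingSet
  have hCg : ‹MeasurableSpace X› = MeasurableSpace.generateFrom C := by
    rw [generateFrom_generateSetAlgebra_eq,
      MeasurableSpace.generateFrom_countableGeneratingSet]
  have hCa : IsSetAlgebra C := isSetAlgebra_generateSetAlgebra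
  have hCm : ∀ A ∈ C, MeasurableSet A := fun A hA => by
    rw [hCg]; exact MeasurableSpace.measurableSet_generateFrom hA
  have := hCc.to_subtype
  have key : ∀ μ ν : pointMeasures R, μ = ν ↔ ∀ (n : ℕ) (A : C),
      (μ : Measure X) (A ∩ R.seq n) = (ν : Measure X) (A ∩ R.seq n) := by
    refine fun μ ν => ⟨fun h => by simp [h], fun h => ext_of_seq R.isLocalisingSeq_seq fun n => ?_⟩
    apply Subtype.ext
    have : IsFiniteMeasure (restrict μ (R.seq n) : Measure X) := ⟨by
      rw [restrict_apply _ MeasurableSet.univ, Set.univ_inter]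
      exact lt_top μ (R.isLocalisingSeq_seq.mem n)⟩
    refine ext_of_generate_finite C hCg hCa.isSetRing.isSetSemiring.isPiSystem (fun A hA => ?_) ?_
    · rw [restrict_apply _ (hCm A hA), restrict_apply _ (hCm A hA)]
      exact h n ⟨A, hA⟩
    · rw [restrict_apply _ MeasurableSet.univ, restrict_apply _ MeasurableSet.univ]
      exact h n ⟨Set.univ, hCa.univ_mem⟩
  refine ⟨?_⟩
  have : Set.diagonal (pointMeasures R) = ⋂ (n : ℕ) (A : C),
      {p | (p.1 : Measure X) (A ∩ R.seq n) = (p.2 : Measure X) (A ∩ R.seq n)} := by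
    ext p
    simp [key, Set.mem_iInter]
  rw [this]
  refine MeasurableSet.iInter fun n => MeasurableSet.iInter fun A => ?_
  have hm := (hCm A A.2).inter (R.measurableSet _ (R.isLocalisingSeq_seq.mem n))
  exact measurableSet_eq_fun ((measurable_apply hm).comp measurable_fst)
    ((measurable_apply hm).comp measurable_snd)

/-- A π-λ argument; intersecting with a ring set keeps all masses finite, so that the complement
step can subtract. -/
theorem measurable_apply_preimage_prodMk_inter {β : Type*} [MeasurableSpace β] {T : Set (β × X)}
    (hT : MeasurableSet T) {A : Set X} (hA : A ∈ R.sets) :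
    Measurable fun p : β × pointMeasures R => (p.2 : Measure X) (Prod.mk p.1 ⁻¹' T ∩ A) := by
  have hAm := R.measurableSet A hA
  induction T, hT using MeasurableSpace.induction_on_inter generateFrom_prod.symm
    isPiSystem_prod with
  | empty => simp
  | basic T hT =>
    obtain ⟨U, hU, V, hV, rfl⟩ := hT
    classical
    have : (fun p : β × pointMeasures R => (p.2 : Measure X) (Prod.mk p.1 ⁻¹' U ×ˢ V ∩ A))
        = (Prod.fst ⁻¹' U).indicator fun p : β × pointMeasures R => (p.2 : Measure X) (V ∩ A) := by
      ext p
      by_cases hp : p.1 ∈ U <;> simp [hp]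
    rw [this]
    exact ((measurable_apply (hV.inter hAm)).comp measurable_snd).indicator (measurable_fst hU)
  | compl T hT ih =>
    have : (fun p : β × pointMeasures R => (p.2 : Measure X) (Prod.mk p.1 ⁻¹' Tᶜ ∩ A))
        = fun p => (p.2 : Measure X) A - (p.2 : Measure X) (Prod.mk p.1 ⁻¹' T ∩ A) := by
      ext p
      rw [← measure_sdiff Set.inter_subset_right
        ((measurable_prodMk_left hT).inter hAm).nullMeasurableSet
        (lt_top p.2 (LocalisingRing.mem_of_subset hA ((measurable_prodMk_left hT).inter hAm)
          Set.inter_subset_right)).ne]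
      congr 1
      ext; simp; tauto
    rw [this]
    exact ((measurable_apply hAm).comp measurable_snd).sub ih
  | iUnion f hd hf ih =>
    have : (fun p : β × pointMeasures R => (p.2 : Measure X) (Prod.mk p.1 ⁻¹' (⋃ i, f i) ∩ A))
        = fun p => ∑' i, (p.2 : Measure X) (Prod.mk p.1 ⁻¹' f i ∩ A) := by
      ext p
      rw [Set.preimage_iUnion, Set.iUnion_inter, measure_iUnion]
      · exact fun i j hij => ((hd hij).preimage _).mono Set.inter_subset_left Set.inter_subset_left
      · exact fun i => (measurable_prodMk_left (hf i)).inter hAm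
    rw [this]
    exact Measurable.tsum ih

theorem measurable_apply_preimage_prodMk {β : Type*} [MeasurableSpace β] {T : Set (β × X)}
    (hT : MeasurableSet T) :
    Measurable fun p : β × pointMeasures R => (p.2 : Measure X) (Prod.mk p.1 ⁻¹' T) := by
  have : (fun p : β × pointMeasures R => (p.2 : Measure X) (Prod.mk p.1 ⁻¹' T))
      = fun p => ⨆ n, (p.2 : Measure X) (Prod.mk p.1 ⁻¹' T ∩ R.seq n) :=
    funext fun p => R.isLocalisingSeq_seq.measure_eq_iSup _ _
  rw [this]
  exact Measurable.iSup fun n =>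
    measurable_apply_preimage_prodMk_inter hT (R.isLocalisingSeq_seq.mem n)

/-- Joint measurability of the restriction to a measurably varying set. -/
theorem measurable_restrict_prodMk {β : Type*} [MeasurableSpace β] {T : Set (β × X)}
    (hT : MeasurableSet T) :
    Measurable fun p : β × pointMeasures R => restrict p.2 (Prod.mk p.1 ⁻¹' T) :=
  measurable_of_apply fun A hA => by
    have := measurable_apply_preimage_prodMk (R := R) (hT.inter (measurable_snd hA))
    convert this using 2 with p
    rw [restrict_apply _ hA, Set.inter_comm]
    rfl

theorem measurable_restrict {S : Set X} (hS : MeasurableSet S) :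
    Measurable fun μ : pointMeasures R => restrict μ S :=
  measurable_of_apply fun A hA => by
    simpa only [restrict_apply _ hA] using measurable_apply (hA.inter hS)

end PointMeasure

/-! ### Finite configurations. -/

namespace PointMeasure

variable {X ι : Type*} [MeasurableSpace X]

/-- The finite point measure `∑ i ∈ s, δ_{x i}`. -/
noncomputable def ofPoints (R : LocalisingRing X) (s : Finset ι) (x : ι → X) : pointMeasures R :=
  ∑ i ∈ s, dirac R (x i)

variable {R : LocalisingRing X}

theorem dirac_apply (x : X) {A : Set X} (hA : MeasurableSet A) :
    (dirac R x : Measure X) A = A.indicator 1 x :=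
  Measure.dirac_apply' x hA

theorem ofPoints_apply (s : Finset ι) (x : ι → X) {A : Set X} (hA : MeasurableSet A) :
    (ofPoints R s x : Measure X) A = ∑ i ∈ s, A.indicator 1 (x i) := by
  simp only [ofPoints, AddSubmonoid.coe_finsetSum, Measure.coe_finsetSum, Finset.sum_apply,
    dirac_apply _ hA]

theorem measurable_ofPoints (s : Finset ι) : Measurable (ofPoints R s : (ι → X) → _) :=
  Finset.measurable_fun_sum s fun i _ => measurable_dirac.comp (measurable_pi_apply i)

open Classical in
theorem restrict_ofPoints (s : Finset ι) (x : ι → X) {T : Set X} (hT : MeasurableSet T) :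
    restrict (ofPoints R s x) T = ofPoints R (s.filter fun i => x i ∈ T) x :=
  ext fun A hA => by
    rw [restrict_apply _ hA, ofPoints_apply _ _ (hA.inter hT), ofPoints_apply _ _ hA,
      Finset.sum_filter]
    refine Finset.sum_congr rfl fun i _ => ?_
    by_cases h : x i ∈ T <;> simp [Set.indicator, h]

theorem eq_of_finite_support [MeasurableSingletonClass X] {μ ν : pointMeasures R} (F : Finset X)
    (hμ : (μ : Measure X) (F : Set X)ᶜ = 0) (hν : (ν : Measure X) (F : Set X)ᶜ = 0)
    (h : ∀ x ∈ F, (μ : Measure X) {x} = (ν : Measure X) {x}) : μ = ν := by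
  classical
  have key : ∀ ρ : Measure X, ρ (F : Set X)ᶜ = 0 → ∀ A, ρ A = ∑ x ∈ F.filter (· ∈ A), ρ {x} := by
    intro ρ hρ A
    rw [sum_measure_singleton, Finset.coe_filter]
    refine (measure_eq_measure_of_null_sdiff (fun x hx => ?_)
      (measure_mono_null (fun x hx hF => ?_) hρ)).symm
    · simp only [Set.mem_ofPred_eq] at hx
      exact hx.2
    · simp only [Set.mem_sdiff, Set.mem_ofPred_eq] at hx
      exact hx.2 ⟨hF, hx.1⟩
  refine ext fun A _ => ?_
  rw [key _ hμ, key _ hν]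
  exact Finset.sum_congr rfl fun x hx => h x (Finset.mem_filter.1 hx).1

end PointMeasure

/-! ### Deterministic properties of generators and hulls. -/

namespace IsGenerator

open PointMeasure

variable {X ι : Type*} [MeasurableSpace X] {R : LocalisingRing X}
  {del : pointMeasures R → pointMeasures R}

theorem del_del (h : IsGenerator del) (μ : pointMeasures R) : del (del μ) = del μ := by
  simpa using h.idempotency μ 0 (by simpa using h.thinning μ)

/-- Consistency for the pair `∂μ ≤ μ`, which have the same image: the discarded points have no
influence on later additions. -/
theorem del_del_add (h : IsGenerator del) (μ ψ : pointMeasures R) :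
    del (del μ + ψ) = del (μ + ψ) :=
  (h.consistency μ (del μ) (h.thinning μ) (h.del_del μ).symm ψ).symm

/-- This is what makes the hull a function of `∂η`, so that conditioning on `∂η` freezes it. -/
theorem hull_del (h : IsGenerator del) (μ : pointMeasures R) :
    generatorHull del (del μ) = generatorHull del μ := by
  ext x
  simp only [generatorHull, Set.mem_ofPred_eq, h.del_del_add, h.del_del]

/-- Points are added one at a time; after each, consistency allows a return to the original `μ`, so
membership in the hull of `μ` alone suffices. -/
theorem del_add_ofPoints (h : IsGenerator del) (s : Finset ι) (x : ι → X) (μ : pointMeasures R)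
    (hs : ∀ i ∈ s, x i ∈ generatorHull del μ) : del (μ + ofPoints R s x) = del μ := by
  classical
  induction s using Finset.induction_on with
  | empty => simp [ofPoints]
  | insert i s hi ih =>
    have h1 : del (μ + dirac R (x i)) = del μ := hs i (Finset.mem_insert_self i s)
    rw [ofPoints, Finset.sum_insert hi, ← add_assoc,
      h.consistency _ μ (by simpa using Measure.le_add_right le_rfl) h1]
    exact ih fun j hj => hs j (Finset.mem_insert_of_mem hj)

theorem measurableSet_hull_graph [MeasurableEq (pointMeasures R)] (h : IsGenerator del) :
    MeasurableSet {p : pointMeasures R × X | p.2 ∈ generatorHull del p.1} :=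
  measurableSet_eq_fun
    (h.measurable.comp (measurable_fst.add (measurable_dirac.comp measurable_snd)))
    (h.measurable.comp measurable_fst)

theorem measurableSet_hull [MeasurableEq (pointMeasures R)] (h : IsGenerator del)
    (μ : pointMeasures R) : MeasurableSet (generatorHull del μ) :=
  measurable_prodMk_left (x := μ) h.measurableSet_hull_graph

theorem measurable_restrict_hull [MeasurableEq (pointMeasures R)] (h : IsGenerator del) :
    Measurable fun p : pointMeasures R × pointMeasures R =>
      restrict p.2 (generatorHull del p.1) :=
  measurable_restrict_prodMk h.measurableSet_hull_graph

variable [MeasurableSingletonClass X]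

/-- Otherwise additivity would give `∂μ = ∂μ + δ_x`, which is impossible since `∂μ` has finite mass
at `x`. -/
theorem del_singleton_eq_zero (h : IsGenerator del) {μ : pointMeasures R} {x : X}
    (hx : x ∈ generatorHull del μ) : (del μ : Measure X) {x} = 0 := by
  by_contra h0
  have h1 := h.additivity μ x (pos_iff_ne_zero.2 h0)
  rw [show del (μ + dirac R x) = del μ from hx] at h1
  have h2 := congrArg (fun ρ : pointMeasures R => (ρ : Measure X) {x}) h1
  simp only [AddSubmonoid.coe_add, Measure.coe_add, Pi.add_apply,
    dirac_apply _ (measurableSet_singleton x)] at h2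
  obtain ⟨k, hk⟩ := (del μ).2 {x} (LocalisingRing.singleton_mem x)
  rw [hk] at h2
  simp only [Set.mem_singleton_iff, Set.indicator_of_mem, Pi.one_apply] at h2
  norm_cast at h2
  omega

/-- Masses at points are integers, so a strict inequality leaves room for a whole `δ_x`: `∂μ + δ_x ≤
μ`. Idempotency then puts `x` in the hull of `∂μ`. -/
theorem mem_hull_of_lt (h : IsGenerator del) {μ : pointMeasures R} {x : X}
    (hx : (del μ : Measure X) {x} < (μ : Measure X) {x}) : x ∈ generatorHull del μ := by
  have hle : ((del μ + dirac R x : pointMeasures R) : Measure X) ≤ (μ : Measure X) := by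
    refine Measure.le_iff.2 fun A hA => ?_
    simp only [AddSubmonoid.coe_add, Measure.coe_add, Pi.add_apply, dirac_apply _ hA]
    by_cases hxA : x ∈ A
    · have hs : ({x} : Set X) ⊆ A := Set.singleton_subset_iff.2 hxA
      rw [Set.indicator_of_mem hxA, ← measure_inter_add_sdiff A (measurableSet_singleton x),
        ← measure_inter_add_sdiff (μ := (μ : Measure X)) A (measurableSet_singleton x),
        Set.inter_eq_self_of_subset_right hs, add_right_comm]
      refine add_le_add ?_ (h.thinning μ _)
      obtain ⟨k, hk⟩ := (del μ).2 {x} (LocalisingRing.singleton_mem x)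
      obtain ⟨l, hl⟩ := μ.2 {x} (LocalisingRing.singleton_mem x)
      rw [hk, hl] at hx ⊢
      simp only [Pi.one_apply]
      norm_cast at hx ⊢
    · simpa [hxA] using h.thinning μ A
  rw [← h.hull_del]
  exact (h.idempotency μ _ hle).trans (h.del_del μ).symm

-- By the two preceding lemmas, at each point `∂μ` has no mass if the point is in the hull and the
-- full mass of `μ` otherwise.
open Classical in
theorem del_ofPoints [MeasurableEq (pointMeasures R)] (h : IsGenerator del) (s : Finset ι)
    (x : ι → X) :
    del (ofPoints R s x) =
      ofPoints R (s.filter fun i => x i ∉ generatorHull del (ofPoints R s x)) x := by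
  set μ := ofPoints R s x with hμdef
  have hm := h.measurableSet_hull μ
  have hμ : (μ : Measure X) ((s.image x : Finset X) : Set X)ᶜ = 0 := by
    rw [ofPoints_apply _ _ (s.image x).measurableSet.compl]
    refine Finset.sum_eq_zero fun i hi => Set.indicator_of_notMem ?_ _
    simp only [Set.mem_compl_iff, not_not, Finset.mem_coe]
    exact Finset.mem_image_of_mem x hi
  have := restrict_ofPoints (R := R) s x hm.compl
  simp only [Set.mem_compl_iff] at this
  rw [← this, ← hμdef]
  refine eq_of_finite_support (s.image x) (le_antisymm (hμ ▸ h.thinning μ _) zero_le)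
    (le_antisymm (hμ ▸ Measure.restrict_le_self _) zero_le) fun y _ => ?_
  rw [restrict_apply _ (measurableSet_singleton y)]
  by_cases hy : y ∈ generatorHull del μ
  · rw [h.del_singleton_eq_zero hy, Set.singleton_inter_eq_empty.2 (by simpa using hy),
      measure_empty]
  · rw [Set.inter_eq_self_of_subset_left (by simpa using hy)]
    exact le_antisymm (h.thinning μ _) (not_lt.1 fun hlt => hy (h.mem_hull_of_lt hlt))

/-- Among the subsets of a finite configuration there is exactly one which is fixed by the
generator and has the remaining points in its hull, namely the one selected by the generator. -/
theorem eq_filter_iff [Fintype ι] [DecidableEq ι] [MeasurableEq (pointMeasures R)]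
    [∀ A : Set X, DecidablePred (· ∈ A)]
    (h : IsGenerator del) (x : ι → X) (s : Finset ι) :
    (del (ofPoints R s x) = ofPoints R s x ∧ ∀ i ∈ sᶜ, x i ∈ generatorHull del (ofPoints R s x)) ↔
      s = Finset.univ.filter fun i => x i ∉ generatorHull del (ofPoints R Finset.univ x) := by
  constructor
  · rintro ⟨h1, h2⟩
    -- The points outside `s` lie in the hull of the fixed configuration on `s`, so adding them does
    -- not change its image.
    have h3 : del (ofPoints R Finset.univ x) = ofPoints R s x := by
      rw [← h1, ← h.del_add_ofPoints sᶜ x _ h2]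
      congr 1
      exact (Finset.sum_add_sum_compl s _).symm
    have h4 : generatorHull del (ofPoints R Finset.univ x) = generatorHull del (ofPoints R s x) := by
      rw [← h.hull_del, h3]
    ext i
    simp only [Finset.mem_filter, Finset.mem_univ, true_and, h4]
    refine ⟨fun hi hmem => ?_, fun hi => by_contra fun his => hi (h2 i (Finset.mem_compl.2 his))⟩
    have h5 := h.del_singleton_eq_zero hmem
    rw [h1, ofPoints_apply _ _ (measurableSet_singleton _), Finset.sum_eq_zero_iff] at h5
    simpa using h5 i hi
  · intro hs
    have h1 : del (ofPoints R Finset.univ x) = ofPoints R s x := by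
      rw [hs]; convert h.del_ofPoints Finset.univ x
    refine ⟨by rw [← h1, h.del_del], fun i hi => ?_⟩
    rw [← h1, h.hull_del]
    simpa [hs] using hi

end IsGenerator

/-! ### Uniqueness of laws through characteristic functionals. -/

namespace PointMeasure

variable {X : Type*} [MeasurableSpace X] {R : LocalisingRing X}

/-- The numbers of points in the members of the localising ring. -/
noncomputable def counts (μ : pointMeasures R) (A : R.sets) : ℝ := (μ : Measure X).real A

theorem measurable_counts : Measurable (counts (R := R)) :=
  measurable_pi_lambda _ fun A => (measurable_apply (R.measurableSet A A.2)).ennreal_toReal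

/-- The mass of any measurable set is the supremum of its masses on the localising sequence, which
are finite; real coordinates thus lose nothing, and Fourier methods apply. -/
theorem measurableSpace_le_comap_counts :
    (inferInstance : MeasurableSpace (pointMeasures R)) ≤
      MeasurableSpace.comap (counts (R := R)) inferInstance := by
  suffices @Measurable _ _ (MeasurableSpace.comap (counts (R := R)) inferInstance) _
      (id : pointMeasures R → pointMeasures R) by
    simpa using this.comap_le
  refine @measurable_of_apply X _ R _ (MeasurableSpace.comap (counts (R := R)) inferInstance) _
    fun A hA => ?_
  have hmem : ∀ n, A ∩ R.seq n ∈ R.sets := fun n => by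
    rw [Set.inter_comm]; exact R.inter_mem _ (R.isLocalisingSeq_seq.mem n) A hA
  have h : (fun μ : pointMeasures R => (μ : Measure X) A) =
      fun μ => ⨆ n, ENNReal.ofReal (counts μ ⟨A ∩ R.seq n, hmem n⟩) := by
    funext μ
    rw [R.isLocalisingSeq_seq.measure_eq_iSup]
    exact iSup_congr fun n => (ENNReal.ofReal_toReal (lt_top μ (hmem n)).ne).symm
  simp only [id]
  rw [h]
  exact Measurable.iSup fun n => ENNReal.measurable_ofReal.comp
    ((measurable_pi_apply (⟨A ∩ R.seq n, hmem n⟩ : R.sets)).comp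
      (comap_measurable (counts (R := R))))

theorem integrable_of_support (μ : Measure X) (f : SimpleFunc X ℝ)
    (hf : μ (Function.support f) < ∞) : Integrable f μ :=
  SimpleFunc.integrable_iff_finMeasSupp.2 hf

/-- A finite measure on the space of point measures is determined by its characteristic
functional on simple functions supported in the localising ring. -/
theorem ext_of_charFun {Q₁ Q₂ : Measure (pointMeasures R)} [IsFiniteMeasure Q₁]
    [IsFiniteMeasure Q₂]
    (h : ∀ f : SimpleFunc X ℝ, Function.support f ∈ R.sets →
      ∫ μ, Complex.exp ((∫ x, f x ∂(μ : Measure X) : ℝ) * Complex.I) ∂Q₁ =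
        ∫ μ, Complex.exp ((∫ x, f x ∂(μ : Measure X) : ℝ) * Complex.I) ∂Q₂) : Q₁ = Q₂ := by
  classical
  have hI : ∀ I : Finset R.sets, Measurable (I.restrict ∘ counts (R := R)) := fun I =>
    (Finset.measurable_restrict I).comp measurable_counts
  have hfin : ∀ I : Finset R.sets, Q₁.map (I.restrict ∘ counts) = Q₂.map (I.restrict ∘ counts) := by
    intro I
    refine Measure.ext_of_charFunDual (funext fun L => ?_)
    -- The weight of `A` is the value of `L` at the corresponding unit vector, so that integrating
    -- `f` against `μ` gives `L` of the counts.
    let f : SimpleFunc X ℝ := ∑ A : I, (SimpleFunc.const X (L (Pi.single A 1))).restrict A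
    have hAm : ∀ A : I, MeasurableSet ((A : R.sets) : Set X) := fun A => R.measurableSet _ A.1.2
    have hf : (f : X → ℝ) = ∑ A : I, ((A : R.sets) : Set X).indicator fun _ => L (Pi.single A 1) := by
      have : ∀ s : Finset I, ((∑ A ∈ s,
          (SimpleFunc.const X (L (Pi.single A 1))).restrict A : SimpleFunc X ℝ) : X → ℝ) =
          ∑ A ∈ s, ((A : R.sets) : Set X).indicator fun _ => L (Pi.single A 1) := by
        intro s
        induction s using Finset.induction_on with
        | empty => rfl
        | insert a s ha ih =>
          rw [Finset.sum_insert ha, Finset.sum_insert ha, SimpleFunc.coe_add, ih,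
            SimpleFunc.coe_restrict _ (hAm a)]
          rfl
      exact this _
    have hS : Function.support f ∈ R.sets := by
      refine LocalisingRing.mem_of_subset (A := ⋃ A ∈ (Finset.univ : Finset I), ((A : R.sets) : Set X))
        (R.isSetRing.biUnion_mem _ fun A _ => A.1.2) f.measurableSet_support fun x hx => ?_
      by_contra hx'
      simp only [Finset.mem_univ, Set.iUnion_true, Set.mem_iUnion, not_exists] at hx'
      refine hx ?_
      rw [hf, Finset.sum_apply]
      exact Finset.sum_eq_zero fun A _ => Set.indicator_of_notMem (hx' A) _
    have hint : ∀ μ : pointMeasures R,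
        ∫ x, f x ∂(μ : Measure X) = L ((I.restrict ∘ counts) μ) := by
      intro μ
      rw [hf]
      simp only [Finset.sum_apply]
      rw [integral_finsetSum _ fun A _ =>
        (integrable_indicator_iff (hAm A)).2 (integrableOn_const (lt_top μ A.1.2).ne)]
      conv_rhs => rw [pi_eq_sum_univ ((I.restrict ∘ counts) μ), map_sum]
      refine Finset.sum_congr rfl fun A _ => ?_
      rw [integral_indicator_const _ (hAm A), map_smul]
      congr 2
      funext j
      simp [Pi.single_apply, eq_comm]
    have hm : ∀ Q : Measure (pointMeasures R), charFunDual (Q.map (I.restrict ∘ counts)) L =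
        ∫ μ, Complex.exp ((∫ x, f x ∂(μ : Measure X) : ℝ) * Complex.I) ∂Q := by
      intro Q
      rw [charFunDual_apply, integral_map (hI I).aemeasurable
        (Continuous.aestronglyMeasurable (by fun_prop))]
      simp only [hint]
    rw [hm, hm, h f hS]
  -- Finite-dimensional marginals determine a finite measure on the product space.
  have hmap : Q₁.map counts = Q₂.map (counts (R := R)) := by
    refine IsProjectiveLimit.unique (P := fun I : Finset R.sets => Q₁.map (I.restrict ∘ counts))
      (fun I => ?_) (fun I => ?_)
    · exact Measure.map_map (Finset.measurable_restrict I) measurable_counts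
    · change _ = Q₁.map (I.restrict ∘ counts)
      rw [hfin]
      exact Measure.map_map (Finset.measurable_restrict I) measurable_counts
  refine Measure.ext fun S hS => ?_
  obtain ⟨T, hT, rfl⟩ := measurableSpace_le_comap_counts S hS
  rw [← Measure.map_apply measurable_counts hT, hmap, Measure.map_apply measurable_counts hT]

end PointMeasure

/-! ### Poisson laws: characteristic functional, uniqueness, restriction. -/

namespace IsPoissonLaw

open PointMeasure

variable {X : Type*} [MeasurableSpace X] {R : LocalisingRing X} {ν : Measure X}
  {Q : Measure (pointMeasures R)}

/-- The alternative `y = 0` serves the zero level set of a simple function, whose intensity may be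
infinite; both sides are then 1. -/
theorem charFun_apply (hQ : IsPoissonLaw ν Q) {A : Set X} (hA : MeasurableSet A) {y : ℝ}
    (hy : ν A ≠ ∞ ∨ y = 0) :
    ∫ μ, Complex.exp ((((μ : Measure X).real A * y : ℝ) : ℂ) * Complex.I) ∂Q =
      Complex.exp (ν.real A * (Complex.exp (y * Complex.I) - 1)) := by
  have := hQ.isProbabilityMeasure
  by_cases h0 : y = 0
  · simp [h0]
  have hA' : ν A ≠ ∞ := hy.resolve_right h0
  have h1 := charFun_map_cast_poissonMeasure (ν A).toNNReal y
  rw [charFun_apply_real, integral_map .of_discrete (by fun_prop)] at h1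
  have h2 : ∫ μ, Complex.exp ((((μ : Measure X).real A * y : ℝ) : ℂ) * Complex.I) ∂Q =
      ∫ a, Complex.exp (((a.toReal * y : ℝ) : ℂ) * Complex.I)
        ∂(Q.map fun μ : pointMeasures R => (μ : Measure X) A) := by
    rw [integral_map (measurable_apply hA).aemeasurable
      (Measurable.aestronglyMeasurable (by fun_prop))]
    rfl
  rw [h2, hQ.map_eq A hA, extendedPoisson, if_neg hA', integral_map .of_discrete
      (Measurable.aestronglyMeasurable (by fun_prop))]
  convert h1 using 4 with k
  · simp [mul_comm]
  · rfl

/-- The level sets of `f` are disjoint, so the exponential factorises into independent Poisson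
characteristic functions. -/
theorem charFun_eq (hQ : IsPoissonLaw ν Q) (hν : ∀ A ∈ R.sets, ν A < ∞) (f : SimpleFunc X ℝ)
    (hf : Function.support f ∈ R.sets) :
    ∫ μ, Complex.exp ((∫ x, f x ∂(μ : Measure X) : ℝ) * Complex.I) ∂Q =
      Complex.exp (∫ x, (Complex.exp (f x * Complex.I) - 1) ∂ν) := by
  have := hQ.isProbabilityMeasure
  let e := f.range.equivFin
  let A : Fin f.range.card → Set X := fun i => f ⁻¹' {(e.symm i : ℝ)}
  have hA : ∀ i, MeasurableSet (A i) := fun i => f.measurableSet_fiber _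
  have hd : Pairwise fun i j => Disjoint (A i) (A j) := fun i j hij =>
    Disjoint.preimage _ (Set.disjoint_singleton.2 fun h => hij (e.symm.injective (Subtype.ext h)))
  have hind := hQ.indep _ A hA hd
  have hprod := hind.integral_fun_prod_comp
    (f := fun i (a : ℝ≥0∞) => Complex.exp (((a.toReal * (e.symm i : ℝ) : ℝ) : ℂ) * Complex.I))
    (fun i => (measurable_apply (hA i)).aemeasurable)
    (fun i => Measurable.aestronglyMeasurable (by fun_prop))
  have hsum : ∀ {M : Type} [AddCommMonoid M] (g : ℝ → M),
      ∑ y ∈ f.range, g y = ∑ i, g (e.symm i) := fun g => by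
    rw [← Finset.sum_coe_sort]
    exact (Equiv.sum_comp e.symm fun y : f.range => g y).symm
  have hl : ∀ μ : pointMeasures R,
      Complex.exp ((∫ x, f x ∂(μ : Measure X) : ℝ) * Complex.I) =
      ∏ i, Complex.exp ((((μ : Measure X) (A i)).toReal * (e.symm i : ℝ) : ℝ) * Complex.I) := by
    intro μ
    rw [← SimpleFunc.integral_eq_integral f (integrable_of_support _ f (lt_top μ hf)),
      SimpleFunc.integral_eq, hsum, ← Complex.exp_sum, ← Finset.sum_mul]
    simp only [smul_eq_mul, Complex.ofReal_sum]
    rfl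
  simp only [hl, hprod]
  have hr : ∫ x, (Complex.exp (f x * Complex.I) - 1) ∂ν =
      ∑ i, (ν.real (A i) : ℂ) * (Complex.exp (((e.symm i : ℝ) : ℂ) * Complex.I) - 1) := by
    have hg := SimpleFunc.map_integral f (fun y : ℝ => Complex.exp ((y : ℂ) * Complex.I) - 1)
      (integrable_of_support ν f (hν _ hf)) (by simp)
    have hi : Integrable (f.map fun y : ℝ => Complex.exp ((y : ℂ) * Complex.I) - 1) ν :=
      SimpleFunc.integrable_iff_finMeasSupp.2
        (SimpleFunc.FinMeasSupp.map (show f.FinMeasSupp ν from hν _ hf) (by simp))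
    rw [SimpleFunc.integral_eq_integral _ hi, hsum] at hg
    simpa [Complex.real_smul] using hg
  rw [hr, Complex.exp_sum]
  refine Finset.prod_congr rfl fun i _ => hQ.charFun_apply (hA i) ?_
  by_cases h0 : (e.symm i : ℝ) = 0
  · exact Or.inr h0
  · refine Or.inl (ne_of_lt ((measure_mono fun x hx => ?_).trans_lt (hν _ hf)))
    have : f x = e.symm i := hx
    rwa [Function.mem_support, this]

theorem unique {Q₁ Q₂ : Measure (pointMeasures R)} (hν : ∀ A ∈ R.sets, ν A < ∞)
    (h₁ : IsPoissonLaw ν Q₁) (h₂ : IsPoissonLaw ν Q₂) : Q₁ = Q₂ := by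
  have := h₁.isProbabilityMeasure
  have := h₂.isProbabilityMeasure
  exact ext_of_charFun fun f hf => by rw [h₁.charFun_eq hν f hf, h₂.charFun_eq hν f hf]

/-- Through this, no general existence theorem for Poisson processes is needed: the law of `η` and
its images under restriction serve as witnesses. -/
theorem poissonLaw_eq (hν : ∀ A ∈ R.sets, ν A < ∞) (hQ : IsPoissonLaw ν Q) :
    poissonLaw R ν = Q := by
  have hex : ∃ Q : Measure (pointMeasures R), IsPoissonLaw ν Q := ⟨Q, hQ⟩
  rw [poissonLaw, dif_pos hex]
  exact unique hν hex.choose_spec hQ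

/-- The restriction of a Poisson process is a Poisson process. -/
theorem map_restrict (hQ : IsPoissonLaw ν Q) {S : Set X} (hS : MeasurableSet S) :
    IsPoissonLaw (ν.restrict S) (Q.map fun μ => restrict μ S) := by
  have := hQ.isProbabilityMeasure
  have hm := measurable_restrict (R := R) hS
  have hp : IsProbabilityMeasure (Q.map fun μ => restrict μ S) :=
    Measure.isProbabilityMeasure_map hm.aemeasurable
  refine ⟨hp, fun A hA => ?_, fun m A hA hd => ?_⟩
  · rw [Measure.map_map (measurable_apply hA) hm, Measure.restrict_apply hA,
      ← hQ.map_eq _ (hA.inter hS)]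
    congr 1
    exact funext fun μ => restrict_apply μ hA
  · have h := hQ.indep m (fun i => A i ∩ S) (fun i => (hA i).inter hS)
      fun i j hij => (hd hij).mono Set.inter_subset_left Set.inter_subset_left
    rw [iIndepFun_iff_map_fun_eq_pi_map
      fun i => (measurable_apply (hA i)).aemeasurable]
    rw [iIndepFun_iff_map_fun_eq_pi_map
      fun i => (measurable_apply ((hA i).inter hS)).aemeasurable] at h
    rw [Measure.map_map (measurable_pi_lambda _ fun i => measurable_apply (hA i)) hm]
    have hmm : ∀ i, (Q.map fun μ => restrict μ S).map (fun μ : pointMeasures R =>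
        (μ : Measure X) (A i)) = Q.map fun μ : pointMeasures R => (μ : Measure X) (A i ∩ S) := fun i => by
      rw [Measure.map_map (measurable_apply (hA i)) hm]
      simp only [Function.comp_def, restrict_apply _ (hA i)]
    simp only [hmm, ← h]
    simp only [Function.comp_def, restrict_apply _ (hA _)]

end IsPoissonLaw

/-! ### The exponential of a finite measure. -/

namespace PointMeasure

variable {X : Type*} [MeasurableSpace X]

/-- The exponential `∑ n, λⁿ / n!` of a finite measure, as a measure on point measures; it is
`exp (λ X)` times the distribution of a Poisson process with intensity measure `λ`. -/
noncomputable def expMeasure (R : LocalisingRing X) (lam : Measure X) : Measure (pointMeasures R) :=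
  Measure.sum fun n : ℕ => ((n.factorial : ℝ≥0∞)⁻¹) •
    (Measure.pi fun _ : Fin n => lam).map (ofPoints R Finset.univ)

variable {R : LocalisingRing X} {lam : Measure X} [IsFiniteMeasure lam]

omit [IsFiniteMeasure lam] in
theorem lintegral_expMeasure {F : pointMeasures R → ℝ≥0∞} (hF : Measurable F) :
    ∫⁻ μ, F μ ∂expMeasure R lam = ∑' n : ℕ, (n.factorial : ℝ≥0∞)⁻¹ *
      ∫⁻ x, F (ofPoints R Finset.univ x) ∂(Measure.pi fun _ : Fin n => lam) := by
  rw [expMeasure, lintegral_sum_measure]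
  refine tsum_congr fun n => ?_
  rw [lintegral_smul_measure, lintegral_map hF (measurable_ofPoints _), smul_eq_mul]

theorem expMeasure_univ :
    expMeasure R lam Set.univ = ENNReal.ofReal (Real.exp (lam.real Set.univ)) := by
  rw [← lintegral_one, lintegral_expMeasure (F := fun _ => 1) measurable_const, Real.exp_eq_exp_ℝ,
    ← (NormedSpace.expSeries_div_hasSum_exp (lam.real Set.univ)).tsum_eq,
    ENNReal.ofReal_tsum_of_nonneg (fun n => by positivity)
      (NormedSpace.expSeries_div_hasSum_exp (lam.real Set.univ)).summable]
  refine tsum_congr fun n => ?_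
  rw [ENNReal.ofReal_div_of_pos (by positivity), ENNReal.ofReal_pow (by positivity),
    ENNReal.ofReal_natCast, ofReal_measureReal, ENNReal.div_eq_inv_mul]
  simp [Measure.pi_univ]

instance : IsFiniteMeasure (expMeasure R lam) := ⟨by simp [expMeasure_univ]⟩

omit [IsFiniteMeasure lam] in
theorem integral_ofPoints {ι : Type*} (s : Finset ι) (x : ι → X) (f : SimpleFunc X ℝ) :
    ∫ y, f y ∂(ofPoints R s x : Measure X) = ∑ i ∈ s, f (x i) := by
  simp only [ofPoints, AddSubmonoid.coe_finsetSum, dirac]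
  rw [integral_finsetSum_measure fun i _ => f.integrable_of_isFiniteMeasure]
  exact Finset.sum_congr rfl fun i _ => integral_dirac' _ _ f.stronglyMeasurable

theorem measurable_integral (f : SimpleFunc X ℝ) (hf : Function.support f ∈ R.sets) :
    Measurable fun μ : pointMeasures R => ∫ x, f x ∂(μ : Measure X) := by
  have : (fun μ : pointMeasures R => ∫ x, f x ∂(μ : Measure X)) =
      fun μ : pointMeasures R => ∑ y ∈ f.range, (μ : Measure X).real (f ⁻¹' {y}) • y := by
    funext μ
    rw [← SimpleFunc.integral_eq_integral f (integrable_of_support _ f (lt_top μ hf)),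
      SimpleFunc.integral_eq]
  rw [this]
  exact Finset.measurable_fun_sum _ fun y _ =>
    (measurable_apply (f.measurableSet_fiber y)).ennreal_toReal.smul_const y

/-- The `n`-th term factorises into an `n`-th power divided by `n!`, leaving the exponential series.
-/
theorem charFun_expMeasure (f : SimpleFunc X ℝ) (hf : Function.support f ∈ R.sets) :
    ∫ μ, Complex.exp ((∫ x, f x ∂(μ : Measure X) : ℝ) * Complex.I) ∂expMeasure R lam =
      Complex.exp (∫ x, Complex.exp (f x * Complex.I) ∂lam) := by
  have hm : Measurable fun μ : pointMeasures R =>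
      Complex.exp ((∫ x, f x ∂(μ : Measure X) : ℝ) * Complex.I) :=
    Complex.measurable_exp.comp
      ((Complex.measurable_ofReal.comp (measurable_integral f hf)).mul_const _)
  have hi : Integrable (fun μ : pointMeasures R =>
      Complex.exp ((∫ x, f x ∂(μ : Measure X) : ℝ) * Complex.I)) (expMeasure R lam) :=
    Integrable.of_bound hm.aestronglyMeasurable 1
      (ae_of_all _ fun μ => (Complex.norm_exp_ofReal_mul_I _).le)
  have h1 := hasSum_integral_measure hi
  have h2 := NormedSpace.expSeries_div_hasSum_exp (∫ x, Complex.exp (f x * Complex.I) ∂lam)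
  rw [← Complex.exp_eq_exp_ℂ] at h2
  have h3 : ∀ n : ℕ, ∫ μ : pointMeasures R,
      Complex.exp ((∫ x, f x ∂(μ : Measure X) : ℝ) * Complex.I) ∂((n.factorial : ℝ≥0∞)⁻¹ •
        (Measure.pi fun _ : Fin n => lam).map (ofPoints R Finset.univ)) =
      (∫ x, Complex.exp (f x * Complex.I) ∂lam) ^ n / n.factorial := by
    intro n
    rw [integral_smul_measure, integral_map (measurable_ofPoints _).aemeasurable
      hm.aestronglyMeasurable]
    simp only [integral_ofPoints, Complex.ofReal_sum, Finset.sum_mul, Complex.exp_sum]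
    rw [integral_fintype_prod_eq_pow (fun x => Complex.exp (f x * Complex.I)), Fintype.card_fin,
      div_eq_inv_mul]
    simp [Complex.real_smul]
  simp only [h3] at h1
  exact h1.unique h2

/-- The exponents of the two characteristic functionals have integrands `exp(i f)` and `exp(i f) -
1`; the difference integrates to `λ X`. -/
theorem _root_.IsPoissonLaw.expMeasure_eq {Q : Measure (pointMeasures R)}
    (hQ : IsPoissonLaw lam Q) :
    expMeasure R lam = ENNReal.ofReal (Real.exp (lam.real Set.univ)) • Q := by
  have := hQ.isProbabilityMeasure
  have : IsFiniteMeasure (ENNReal.ofReal (Real.exp (lam.real Set.univ)) • Q) :=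
    Measure.smul_finite Q ENNReal.ofReal_ne_top
  refine ext_of_charFun fun f hf => ?_
  have hi : Integrable (fun x => Complex.exp (f x * Complex.I)) lam :=
    Integrable.of_bound (Measurable.aestronglyMeasurable
      (Complex.measurable_exp.comp ((Complex.measurable_ofReal.comp f.measurable).mul_const _))) 1
      (ae_of_all _ fun x => (Complex.norm_exp_ofReal_mul_I _).le)
  rw [charFun_expMeasure f hf, integral_smul_measure, hQ.charFun_eq (fun A _ => measure_lt_top _ _) f hf,
    integral_sub hi (integrable_const _), ENNReal.toReal_ofReal (Real.exp_pos _).le]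
  rw [Complex.real_smul, Complex.ofReal_exp, ← Complex.exp_add, integral_const]
  simp

theorem _root_.IsPoissonLaw.lintegral_expMeasure_restrict {Q : Measure (pointMeasures R)}
    (hQ : IsPoissonLaw lam Q) {S : Set X}
    (hS : MeasurableSet S) {F : pointMeasures R → ℝ≥0∞} (hF : Measurable F) :
    ∫⁻ ψ, F ψ ∂expMeasure R (lam.restrict S) =
      ENNReal.ofReal (Real.exp ((lam.restrict S).real Set.univ)) * ∫⁻ ψ, F (restrict ψ S) ∂Q := by
  rw [(hQ.map_restrict hS).expMeasure_eq, lintegral_smul_measure,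
    lintegral_map hF (measurable_restrict hS), smul_eq_mul]

/-- A configuration has no point outside `S` exactly when all its coordinates are in `S`, and
restricting a product measure to `Sⁿ` restricts each factor. -/
theorem restrict_expMeasure {S : Set X} (hS : MeasurableSet S) :
    (expMeasure R lam).restrict {μ | (μ : Measure X) Sᶜ = 0} = expMeasure R (lam.restrict S) := by
  have hm : MeasurableSet {μ : pointMeasures R | (μ : Measure X) Sᶜ = 0} :=
    measurable_apply hS.compl (measurableSet_singleton 0)
  rw [expMeasure, Measure.restrict_sum _ hm, expMeasure]
  congr 1
  funext n
  rw [Measure.restrict_smul, Measure.restrict_map (measurable_ofPoints _) hm,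
    ← Measure.restrict_pi_pi]
  congr 3
  ext x
  simp [ofPoints_apply _ _ hS.compl]

/-- Splitting `Fin n` produces subtypes as index sets; only their cardinality matters. -/
theorem lintegral_pi_ofPoints_eq_fin {κ : Type*} [Fintype κ] {n : ℕ} (hn : Fintype.card κ = n)
    (F : pointMeasures R → ℝ≥0∞) :
    ∫⁻ y, F (ofPoints R Finset.univ y) ∂(Measure.pi fun _ : κ => lam) =
      ∫⁻ y, F (ofPoints R Finset.univ y) ∂(Measure.pi fun _ : Fin n => lam) := by
  let e : Fin n ≃ κ := (Fintype.equivFinOfCardEq hn).symm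
  rw [← (measurePreserving_piCongrLeft (fun _ : κ => lam) e).lintegral_comp_emb
    (MeasurableEquiv.measurableEmbedding _)]
  refine lintegral_congr fun y => congrArg F ?_
  rw [ofPoints, ofPoints, ← e.sum_comp]
  refine Finset.sum_congr rfl fun i _ => congrArg _ ?_
  exact Equiv.piCongrLeft_apply_apply (fun _ => X) e y i

theorem lintegral_ofPoints_filter {ι : Type*} [Fintype ι] (p : ι → Prop) [DecidablePred p]
    {k l : ℕ} (hk : Fintype.card {i // p i} = k) (hl : Fintype.card {i // ¬p i} = l)
    {G : pointMeasures R × pointMeasures R → ℝ≥0∞} (hG : Measurable G) :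
    ∫⁻ x, G (ofPoints R {i | p i} x, ofPoints R {i | ¬p i} x) ∂(Measure.pi fun _ : ι => lam) =
      ∫⁻ y, ∫⁻ z, G (ofPoints R Finset.univ y, ofPoints R Finset.univ z)
        ∂(Measure.pi fun _ : Fin l => lam) ∂(Measure.pi fun _ : Fin k => lam) := by
  have h1 : ∀ x : ι → X, G (ofPoints R {i | p i} x, ofPoints R {i | ¬p i} x) =
      (fun q : ({i // p i} → X) × ({i // ¬p i} → X) =>
        G (ofPoints R Finset.univ q.1, ofPoints R Finset.univ q.2))
        (MeasurableEquiv.piEquivPiSubtypeProd (fun _ => X) p x) := by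
    intro x
    have ha : ofPoints R {i | p i} x = ofPoints R Finset.univ fun i : {i // p i} => x i :=
      Finset.sum_subtype _ (by simp) fun i => dirac R (x i)
    have hb : ofPoints R {i | ¬p i} x = ofPoints R Finset.univ fun i : {i // ¬p i} => x i :=
      Finset.sum_subtype _ (by simp) fun i => dirac R (x i)
    rw [ha, hb]
    rfl
  have hGm : Measurable fun q : ({i // p i} → X) × ({i // ¬p i} → X) =>
      G (ofPoints R Finset.univ q.1, ofPoints R Finset.univ q.2) :=
    hG.comp (((measurable_ofPoints _).comp measurable_fst).prodMk
      ((measurable_ofPoints _).comp measurable_snd))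
  simp_rw [h1]
  rw [(measurePreserving_piEquivPiSubtypeProd (fun _ : ι => lam) p).lintegral_comp hGm,
    lintegral_prod _ hGm.aemeasurable]
  refine (lintegral_pi_ofPoints_eq_fin hk fun μ =>
    ∫⁻ z : {i // ¬p i} → X, G (μ, ofPoints R Finset.univ z)
      ∂(Measure.pi fun _ => lam)).trans ?_
  exact lintegral_congr fun y => lintegral_pi_ofPoints_eq_fin hl fun ψ => G (_, ψ)

theorem lintegral_ofPoints_compl {n : ℕ} (s : Finset (Fin n))
    {G : pointMeasures R × pointMeasures R → ℝ≥0∞} (hG : Measurable G) :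
    ∫⁻ x, G (ofPoints R s x, ofPoints R sᶜ x) ∂(Measure.pi fun _ : Fin n => lam) =
      ∫⁻ y, ∫⁻ z, G (ofPoints R Finset.univ y, ofPoints R Finset.univ z)
        ∂(Measure.pi fun _ : Fin (n - s.card) => lam) ∂(Measure.pi fun _ : Fin s.card => lam) := by
  have hk : Fintype.card {i // i ∈ s} = s.card := Fintype.card_coe s
  have hl : Fintype.card {i // i ∉ s} = n - s.card := by
    rw [Fintype.card_subtype_compl]; simp
  rw [← lintegral_ofPoints_filter (· ∈ s) (by convert hk) hl hG]
  have hs : Finset.univ.filter (· ∈ s) = s := by ext; simp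
  have hs' : Finset.univ.filter (· ∉ s) = sᶜ := by ext; simp
  rw [hs, hs']

/-- Splitting the configurations of the exponential measure into two in all possible ways
gives the product of the exponential measure with itself. -/
theorem tsum_lintegral_sum_ofPoints_compl {G : pointMeasures R × pointMeasures R → ℝ≥0∞}
    (hG : Measurable G) :
    ∑' n : ℕ, (n.factorial : ℝ≥0∞)⁻¹ * ∫⁻ x, ∑ s : Finset (Fin n),
        G (ofPoints R s x, ofPoints R sᶜ x) ∂(Measure.pi fun _ : Fin n => lam) =
      ∫⁻ μ, ∫⁻ ψ, G (μ, ψ) ∂expMeasure R lam ∂expMeasure R lam := by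
  have hGs : Measurable fun μ => ∫⁻ ψ, G (μ, ψ) ∂expMeasure R lam := hG.lintegral_prod_right'
  let a : ℕ → ℕ → ℝ≥0∞ := fun k l =>
    ∫⁻ y, ∫⁻ z, G (ofPoints R Finset.univ y, ofPoints R Finset.univ z)
      ∂(Measure.pi fun _ : Fin l => lam) ∂(Measure.pi fun _ : Fin k => lam)
  have hG1 : ∀ k l, Measurable fun p : (Fin k → X) × (Fin l → X) =>
      G (ofPoints R Finset.univ p.1, ofPoints R Finset.univ p.2) := fun k l =>
    hG.comp (((measurable_ofPoints _).comp measurable_fst).prodMk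
      ((measurable_ofPoints _).comp measurable_snd))
  have hR : ∫⁻ μ, ∫⁻ ψ, G (μ, ψ) ∂expMeasure R lam ∂expMeasure R lam =
      ∑' (k : ℕ) (l : ℕ), (k.factorial : ℝ≥0∞)⁻¹ * ((l.factorial : ℝ≥0∞)⁻¹ * a k l) := by
    rw [lintegral_expMeasure hGs]
    refine tsum_congr fun k => ?_
    rw [ENNReal.tsum_mul_left]
    congr 1
    have hin : ∀ μ, ∫⁻ ψ, G (μ, ψ) ∂expMeasure R lam = _ := fun μ =>
      lintegral_expMeasure (hG.comp measurable_prodMk_left)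
    simp_rw [hin]
    rw [lintegral_tsum fun l => ((hG1 k l).lintegral_prod_right'.const_mul _).aemeasurable]
    exact tsum_congr fun l => lintegral_const_mul _ (hG1 k l).lintegral_prod_right'
  rw [hR, ← ENNReal.tsum_prod, ← Finset.HasAntidiagonal.sigmaAntidiagonalEquivProd.tsum_eq, ENNReal.tsum_sigma']
  refine tsum_congr fun n => ?_
  have h1 : ∀ s : Finset (Fin n), Measurable fun x : Fin n → X =>
      G (ofPoints R s x, ofPoints R sᶜ x) := fun s =>
    hG.comp ((measurable_ofPoints _).prodMk (measurable_ofPoints _))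
  rw [tsum_fintype, lintegral_finsetSum _ fun s _ => h1 s]
  simp_rw [lintegral_ofPoints_compl _ hG]
  -- A summand depends on `s` only through its cardinality `k`, which occurs `n.choose k` times; the
  -- identity `n.choose k / n! = 1 / (k! l!)` with `k + l = n` finishes the proof.
  have h2 := Finset.sum_powerset_apply_card (fun k => a k (n - k)) (x := (Finset.univ : Finset (Fin n)))
  rw [Finset.powerset_univ, Finset.card_univ, Fintype.card_fin] at h2
  rw [show (∑ s : Finset (Fin n), ∫⁻ y, ∫⁻ z, G (ofPoints R Finset.univ y, ofPoints R Finset.univ z)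
        ∂(Measure.pi fun _ : Fin (n - s.card) => lam) ∂(Measure.pi fun _ : Fin s.card => lam)) =
      ∑ s : Finset (Fin n), a s.card (n - s.card) from rfl, h2,
    ← Finset.Nat.sum_antidiagonal_eq_sum_range_succ (fun k l => n.choose k • a k l),
    Finset.mul_sum, ← Finset.sum_coe_sort]
  refine Finset.sum_congr rfl fun p _ => ?_
  obtain ⟨⟨k, l⟩, hp⟩ := p
  have hkl : k + l = n := Finset.HasAntidiagonal.mem_antidiagonal.1 hp
  subst hkl
  simp only [Finset.HasAntidiagonal.sigmaAntidiagonalEquivProd_apply, nsmul_eq_mul, ← mul_assoc]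
  congr 1
  rw [← Nat.add_choose_mul_factorial_mul_factorial k l, ← Nat.choose_symm_add]
  push_cast
  have hc : ((k + l).choose k : ℝ≥0∞) ≠ 0 := by
    exact_mod_cast (Nat.choose_pos (Nat.le_add_right k l)).ne'
  rw [ENNReal.mul_inv (by right; simp) (by right; positivity),
    ENNReal.mul_inv (by right; simp) (by right; positivity)]
  rw [mul_comm, ← mul_assoc, ← mul_assoc, ENNReal.mul_inv_cancel hc (by simp), one_mul]

end PointMeasure

/-! ### The Markov property for finite intensity. -/

namespace IsGenerator

open PointMeasure

variable {X : Type*} [MeasurableSpace X] {R : LocalisingRing X} [MeasurableEq (pointMeasures R)]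
  {del : pointMeasures R → pointMeasures R}

theorem measurable_del_restrict_hull (h : IsGenerator del) :
    Measurable fun p : pointMeasures R × pointMeasures R =>
      (del p.1, restrict p.2 (generatorHull del p.1)) :=
  (h.measurable.comp measurable_fst).prodMk h.measurable_restrict_hull

theorem measurable_del_restrict_hull_self (h : IsGenerator del) :
    Measurable fun μ : pointMeasures R => (del μ, restrict μ (generatorHull del μ)) :=
  h.measurable_del_restrict_hull.comp (measurable_id.prodMk measurable_id)

variable [MeasurableSingletonClass X] {lam : Measure X} [IsFiniteMeasure lam]
  {Q : Measure (pointMeasures R)}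

/-- Decomposition of a finite configuration with respect to the exponential measure. -/
theorem lintegral_expMeasure_split (h : IsGenerator del)
    {F : pointMeasures R × pointMeasures R → ℝ≥0∞} (hF : Measurable F) :
    ∫⁻ μ, F (del μ, restrict μ (generatorHull del μ)) ∂expMeasure R lam =
      ∫⁻ μ, {μ | del μ = μ}.indicator (fun μ => ∫⁻ ψ, F (μ, ψ)
        ∂expMeasure R (lam.restrict (generatorHull del μ))) μ ∂expMeasure R lam := by
  classical
  -- The admissible splittings: a fixed first part, and a second part carried by the hull of the
  -- first. For each configuration exactly one subset of indices gives a pair in `T`.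
  let T : Set (pointMeasures R × pointMeasures R) :=
    {p | del p.1 = p.1} ∩ {p | (p.2 : Measure X) (generatorHull del p.1)ᶜ = 0}
  have hT : MeasurableSet T :=
    (measurableSet_eq_fun (h.measurable.comp measurable_fst) measurable_fst).inter
      (measurable_apply_preimage_prodMk h.measurableSet_hull_graph.compl (measurableSet_singleton 0))
  have hF' : Measurable fun μ : pointMeasures R => F (del μ, restrict μ (generatorHull del μ)) :=
    hF.comp h.measurable_del_restrict_hull_self
  rw [lintegral_expMeasure hF']
  calc _ = ∑' n : ℕ, (n.factorial : ℝ≥0∞)⁻¹ * ∫⁻ x, ∑ s : Finset (Fin n),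
        T.indicator F (ofPoints R s x, ofPoints R sᶜ x) ∂(Measure.pi fun _ : Fin n => lam) := by
        refine tsum_congr fun n => congrArg _ (lintegral_congr fun x => ?_)
        have hTs : ∀ s : Finset (Fin n), (ofPoints R s x, ofPoints R sᶜ x) ∈ T ↔
            s = Finset.univ.filter fun i =>
              x i ∉ generatorHull del (ofPoints R Finset.univ x) := by
          intro s
          rw [← h.eq_filter_iff x s]
          refine and_congr_right fun _ => ?_
          change (ofPoints R sᶜ x : Measure X) (generatorHull del (ofPoints R s x))ᶜ = 0 ↔ _
          rw [ofPoints_apply _ _ (h.measurableSet_hull _).compl, Finset.sum_eq_zero_iff]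
          refine forall₂_congr fun i _ => ?_
          simp
        set s₀ := Finset.univ.filter fun i =>
          x i ∉ generatorHull del (ofPoints R Finset.univ x) with hs₀
        rw [Finset.sum_eq_single s₀ (fun s _ hs => Set.indicator_of_notMem
          (fun hmem => hs ((hTs s).1 hmem)) _) (fun hs => absurd (Finset.mem_univ _) hs),
          Set.indicator_of_mem ((hTs s₀).2 rfl), h.del_ofPoints,
          restrict_ofPoints _ _ (h.measurableSet_hull _)]
        have hc : s₀ᶜ = Finset.univ.filter fun i =>
            x i ∈ generatorHull del (ofPoints R Finset.univ x) := by
          ext i; simp [hs₀]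
        rw [hc]
    _ = ∫⁻ μ, ∫⁻ ψ, T.indicator F (μ, ψ) ∂expMeasure R lam ∂expMeasure R lam :=
        tsum_lintegral_sum_ofPoints_compl (hF.indicator hT)
    _ = _ := by
        refine lintegral_congr fun μ => ?_
        by_cases hμ : del μ = μ
        · have hS := h.measurableSet_hull μ
          have hS0 : MeasurableSet {ψ : pointMeasures R |
              (ψ : Measure X) (generatorHull del μ)ᶜ = 0} :=
            measurable_apply hS.compl (measurableSet_singleton 0)
          rw [Set.indicator_of_mem (show μ ∈ {μ | del μ = μ} from hμ), ← restrict_expMeasure hS,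
            ← lintegral_indicator hS0]
          refine lintegral_congr fun ψ => ?_
          by_cases hψ : (ψ : Measure X) (generatorHull del μ)ᶜ = 0
          · rw [Set.indicator_of_mem (show (μ, ψ) ∈ T from ⟨hμ, hψ⟩)]
            exact (Set.indicator_of_mem (s := {ψ : pointMeasures R |
              (ψ : Measure X) (generatorHull del μ)ᶜ = 0}) hψ fun ψ => F (μ, ψ)).symm
          · rw [Set.indicator_of_notMem (fun hmem : (μ, ψ) ∈ T => hψ hmem.2)]
            exact (Set.indicator_of_notMem (s := {ψ : pointMeasures R |
              (ψ : Measure X) (generatorHull del μ)ᶜ = 0}) hψ fun ψ => F (μ, ψ)).symm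
        · rw [Set.indicator_of_notMem (show μ ∉ {μ | del μ = μ} from hμ)]
          simp only [Set.indicator_of_notMem (fun hmem : (μ, _) ∈ T => hμ hmem.1), lintegral_zero]

/-- The strong Markov property of the hull for a finite intensity measure. -/
theorem map_del_restrict_hull_of_finite (h : IsGenerator del) (hQ : IsPoissonLaw lam Q) :
    Q.map (fun μ => (del μ, restrict μ (generatorHull del μ))) =
      (Q.prod Q).map fun p => (del p.1, restrict p.2 (generatorHull del p.1)) := by
  have := hQ.isProbabilityMeasure
  refine Measure.ext_of_lintegral _ fun F hF => ?_
  have hF' : Measurable fun p : pointMeasures R × pointMeasures R =>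
      F (del p.1, restrict p.2 (generatorHull del p.1)) :=
    hF.comp h.measurable_del_restrict_hull
  rw [lintegral_map hF h.measurable_del_restrict_hull_self,
    lintegral_map hF h.measurable_del_restrict_hull, lintegral_prod _ hF'.aemeasurable]
  -- The average of `F` over an independent copy in the second argument. The splitting formula is
  -- used for `F` and for `H`; the factor `exp(λ [μ])` appears in both results and never has to be
  -- evaluated.
  let H : pointMeasures R → ℝ≥0∞ := fun μ => ∫⁻ ψ, F (μ, restrict ψ (generatorHull del μ)) ∂Q
  have hH : Measurable H :=
    (hF.comp (measurable_fst.prodMk h.measurable_restrict_hull)).lintegral_prod_right'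
  have key : ∫⁻ μ, F (del μ, restrict μ (generatorHull del μ)) ∂expMeasure R lam =
      ∫⁻ μ, H (del μ) ∂expMeasure R lam := by
    rw [h.lintegral_expMeasure_split hF,
      h.lintegral_expMeasure_split (F := fun p => H p.1) (hH.comp measurable_fst)]
    refine lintegral_congr fun μ => congrFun (congrArg _ (funext fun μ => ?_)) μ
    have hS := h.measurableSet_hull μ
    rw [hQ.lintegral_expMeasure_restrict hS (F := fun ψ => F (μ, ψ)) (hF.comp measurable_prodMk_left),
      hQ.lintegral_expMeasure_restrict hS (F := fun _ => H μ) measurable_const]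
    simp [H]
  simp only [H, h.hull_del] at key
  rw [hQ.expMeasure_eq, lintegral_smul_measure, lintegral_smul_measure, smul_eq_mul,
    smul_eq_mul] at key
  exact (ENNReal.mul_right_inj (ENNReal.ofReal_pos.2 (Real.exp_pos _)).ne'
    ENNReal.ofReal_ne_top).1 key

end IsGenerator

/-! ### Limits of laws under coincidence with high probability. -/

theorem MeasureTheory.measure_preimage_le_add_measure_ne {Ω Y : Type*} [MeasurableSpace Ω]
    (P : Measure Ω) (T : Set Y) (f g : Ω → Y) :
    P (f ⁻¹' T) ≤ P (g ⁻¹' T) + P {ω | g ω ≠ f ω} := by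
  refine (measure_mono fun ω hω => ?_).trans (measure_union_le _ _)
  by_cases h : g ω = f ω
  · exact Or.inl (by simpa [h] using hω)
  · exact Or.inr h

theorem MeasureTheory.measure_preimage_le_add_measure_ne' {Ω Y : Type*} [MeasurableSpace Ω]
    (P : Measure Ω) (T : Set Y) (f g : Ω → Y) :
    P (g ⁻¹' T) ≤ P (f ⁻¹' T) + P {ω | g ω ≠ f ω} := by
  simpa only [ne_comm] using measure_preimage_le_add_measure_ne P T g f

/-- Two laws agree if they are limits, in the sense of coincidence with probability tending to
one, of laws that agree. -/
theorem MeasureTheory.Measure.map_eq_of_tendsto_measure_ne {Ω Ω' Y : Type*} [MeasurableSpace Ω]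
    [MeasurableSpace Ω'] [MeasurableSpace Y] {P : Measure Ω} {P' : Measure Ω'}
    {f : ℕ → Ω → Y} {f' : ℕ → Ω' → Y} {g : Ω → Y} {g' : Ω' → Y}
    (hf : ∀ n, Measurable (f n)) (hf' : ∀ n, Measurable (f' n)) (hg : Measurable g)
    (hg' : Measurable g') (hmap : ∀ᶠ n in atTop, P.map (f n) = P'.map (f' n))
    (h : Tendsto (fun n => P {ω | f n ω ≠ g ω}) atTop (𝓝 0))
    (h' : Tendsto (fun n => P' {ω | f' n ω ≠ g' ω}) atTop (𝓝 0)) :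
    P.map g = P'.map g' := by
  refine Measure.ext fun T hT => ?_
  rw [Measure.map_apply hg hT, Measure.map_apply hg' hT]
  have hsum : Tendsto (fun n => P {ω | f n ω ≠ g ω} + P' {ω | f' n ω ≠ g' ω}) atTop (𝓝 0) := by
    simpa using h.add h'
  have heq : ∀ᶠ n in atTop, P (f n ⁻¹' T) = P' (f' n ⁻¹' T) := hmap.mono fun n hn => by
    rw [← Measure.map_apply (hf n) hT, hn, Measure.map_apply (hf' n) hT]
  refine le_antisymm ?_ ?_
  · have h1 : ∀ᶠ n in atTop, P (g ⁻¹' T) ≤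
        P' (g' ⁻¹' T) + (P {ω | f n ω ≠ g ω} + P' {ω | f' n ω ≠ g' ω}) := heq.mono fun n hn => by
      refine (measure_preimage_le_add_measure_ne P T g (f n)).trans ?_
      rw [hn, add_comm (P _) (P' {ω | _}), ← add_assoc]
      gcongr
      exact measure_preimage_le_add_measure_ne' P' T g' (f' n)
    simpa using ge_of_tendsto (tendsto_const_nhds.add hsum) h1
  · have h1 : ∀ᶠ n in atTop, P' (g' ⁻¹' T) ≤
        P (g ⁻¹' T) + (P {ω | f n ω ≠ g ω} + P' {ω | f' n ω ≠ g' ω}) := heq.mono fun n hn => by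
      refine (measure_preimage_le_add_measure_ne P' T g' (f' n)).trans ?_
      rw [← hn, ← add_assoc]
      gcongr
      exact measure_preimage_le_add_measure_ne' P T g (f n)
    simpa using ge_of_tendsto (tendsto_const_nhds.add hsum) h1

theorem MeasureTheory.tendsto_measure_compl_of_tendsto_one {Ω : Type*} [MeasurableSpace Ω]
    {P : Measure Ω} [IsProbabilityMeasure P] {s : ℕ → Set Ω} (hs : ∀ n, MeasurableSet (s n))
    (h : Tendsto (fun n => P (s n)) atTop (𝓝 1)) :
    Tendsto (fun n => P (s n)ᶜ) atTop (𝓝 0) := by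
  simp only [prob_compl_eq_one_sub (hs _)]
  simpa using ENNReal.Tendsto.sub tendsto_const_nhds h (Or.inl ENNReal.one_ne_top)

namespace PointMeasure

variable {X : Type*} [MeasurableSpace X] {R : LocalisingRing X}

theorem measurable_prodMap_restrict {S : Set X} (hS : MeasurableSet S) :
    Measurable fun p : pointMeasures R × pointMeasures R => (restrict p.1 S, restrict p.2 S) :=
  ((measurable_restrict hS).comp measurable_fst).prodMk
    ((measurable_restrict hS).comp measurable_snd)

/-- A law of a pair of point measures is determined by the laws of the restrictions to the sets
of a localising sequence. -/
theorem prod_ext_of_restrict {B : ℕ → Set X} (hB : IsLocalisingSeq R.sets B)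
    {M₁ M₂ : Measure (pointMeasures R × pointMeasures R)} [IsFiniteMeasure M₁]
    (h : ∀ m, M₁.map (fun p => (restrict p.1 (B m), restrict p.2 (B m))) =
      M₂.map fun p => (restrict p.1 (B m), restrict p.2 (B m))) : M₁ = M₂ := by
  have hBm : ∀ m, MeasurableSet (B m) := fun m => R.measurableSet _ (hB.mem m)
  let r : ℕ → pointMeasures R × pointMeasures R → pointMeasures R × pointMeasures R :=
    fun m p => (restrict p.1 (B m), restrict p.2 (B m))
  have hr : ∀ m, Measurable (r m) := fun m => measurable_prodMap_restrict (hBm m)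
  have hrr : ∀ m k, m ≤ k → ∀ p, r m (r k p) = r m p := fun m k hmk p => by
    simp only [r, restrict_restrict _ (hBm m), Set.inter_eq_self_of_subset_right (hB.mono hmk)]
  -- Events depending only on what happens in some `B m`. They form a π-system because `B (max m k)`
  -- sees both levels, and they generate because masses are suprema over `m`.
  let C : Set (Set (pointMeasures R × pointMeasures R)) :=
    {S | ∃ m T, MeasurableSet T ∧ r m ⁻¹' T = S}
  have hgen : (inferInstance : MeasurableSpace (pointMeasures R × pointMeasures R)) =
      MeasurableSpace.generateFrom C := by
    refine le_antisymm ?_ (MeasurableSpace.generateFrom_le ?_)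
    · have hrC : ∀ m, @Measurable _ _ (MeasurableSpace.generateFrom C) _ (r m) := fun m T hT =>
        MeasurableSpace.measurableSet_generateFrom ⟨m, T, hT, rfl⟩
      have hC : ∀ f : pointMeasures R × pointMeasures R → pointMeasures R, Measurable f →
          (∀ m p, restrict (f p) (B m) = f (r m p)) →
          @Measurable _ _ (MeasurableSpace.generateFrom C) _ f := by
        intro f hf hfr
        refine @measurable_of_apply X _ R _ (MeasurableSpace.generateFrom C) f fun A hA => ?_
        have hsup : (fun p => (f p : Measure X) A) = fun p => ⨆ m, (f (r m p) : Measure X) A := by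
          funext p
          rw [hB.measure_eq_iSup]
          exact iSup_congr fun m => by rw [← hfr, restrict_apply _ hA]
        rw [hsup]
        exact Measurable.iSup fun m => ((measurable_apply hA).comp hf).comp (hrC m)
      have hid : @Measurable _ _ (MeasurableSpace.generateFrom C) _
          (id : pointMeasures R × pointMeasures R → _) :=
        (hC Prod.fst measurable_fst fun _ _ => rfl).prodMk
          (hC Prod.snd measurable_snd fun _ _ => rfl)
      simpa using hid.comap_le
    · rintro _ ⟨m, T, hT, rfl⟩
      exact hr m hT
  have hpi : IsPiSystem C := by
    rintro _ ⟨m, T, hT, rfl⟩ _ ⟨k, T', hT', rfl⟩ _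
    refine ⟨max m k, r m ⁻¹' T ∩ r k ⁻¹' T', (hr m hT).inter (hr k hT'), ?_⟩
    ext p
    simp only [Set.mem_preimage, Set.mem_inter_iff, hrr m _ (le_max_left m k),
      hrr k _ (le_max_right m k)]
  have heq : ∀ m T, MeasurableSet T → M₁ (r m ⁻¹' T) = M₂ (r m ⁻¹' T) := fun m T hT => by
    rw [← Measure.map_apply (hr m) hT, ← Measure.map_apply (hr m) hT, h m]
  refine ext_of_generate_finite C hgen hpi ?_ (heq 0 Set.univ MeasurableSet.univ)
  rintro _ ⟨m, T, hT, rfl⟩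
  exact heq m T hT

end PointMeasure

/-! ### The Markov property for locally finite intensity. -/

section Markov

open PointMeasure

variable {X Ω : Type*} [MeasurableSpace X] [StandardBorelSpace X]
    [MeasurableSpace Ω] {P : Measure Ω} [IsProbabilityMeasure P]
    {R : LocalisingRing X} {B : ℕ → Set X} {lam : Measure X} {η : Ω → pointMeasures R}
    {del : pointMeasures R → pointMeasures R}

/-- The Markov property for the process in a set of the localising ring. -/
theorem IsPoissonProcess.map_del_restrict_hull_of_mem (hη : IsPoissonProcess η lam P)
    (hdel : IsGenerator del) (hlam : ∀ A ∈ R.sets, lam A < ∞) {D E : Set X} (hD : D ∈ R.sets)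
    (hE : MeasurableSet E) (hED : E ⊆ D) :
    P.map (fun ω => (restrict (del (restrict (η ω) D)) E,
        restrict (η ω) (generatorHull del (restrict (η ω) D) ∩ E))) =
      (P.prod (P.map η)).map fun p => (restrict (del (restrict (η p.1) D)) E,
        restrict p.2 (generatorHull del (restrict (η p.1) D) ∩ E)) := by
  have := measurableEq (R := R)
  have hDm := R.measurableSet D hD
  have hrD := measurable_restrict (R := R) hDm
  have hηD : Measurable fun ω => restrict (η ω) D := hrD.comp hη.measurable
  have : IsFiniteMeasure (lam.restrict D) := ⟨by simpa using hlam D hD⟩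
  have hP : IsProbabilityMeasure (P.map η) := hη.law.isProbabilityMeasure
  have hrE := measurable_prodMap_restrict (R := R) hE
  -- The finite case for `λ` restricted to `D`, pushed forward by restriction to `E`; since `E ⊆ D`,
  -- the restriction to `D` then disappears from the outer measures.
  have key := congrArg (Measure.map fun p => (restrict p.1 E, restrict p.2 E))
    (hdel.map_del_restrict_hull_of_finite (hη.law.map_restrict hDm))
  have hset : ∀ S : Set X, D ∩ (S ∩ E) = S ∩ E := fun S =>
    Set.inter_eq_self_of_subset_right (Set.inter_subset_right.trans hED)
  have hmap : (P.map η).map (fun μ => restrict μ D) = P.map fun ω => restrict (η ω) D :=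
    Measure.map_map hrD hη.measurable
  have hprod : ((P.map η).map fun μ => restrict μ D).prod ((P.map η).map fun μ => restrict μ D) =
      (P.prod (P.map η)).map (Prod.map (fun ω => restrict (η ω) D) fun μ => restrict μ D) := by
    rw [← Measure.map_prod_map _ _ hηD hrD, hmap]
  rw [hprod, hmap, Measure.map_map hrE hdel.measurable_del_restrict_hull_self,
    Measure.map_map hrE hdel.measurable_del_restrict_hull,
    Measure.map_map (hrE.comp hdel.measurable_del_restrict_hull_self) hηD,
    Measure.map_map (hrE.comp hdel.measurable_del_restrict_hull) (hηD.prodMap hrD)] at key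
  simpa [Function.comp_def, restrict_restrict _ hE,
    restrict_restrict _ ((hdel.measurableSet_hull _).inter hE), hset] using key

/-- The strong Markov property of the hull, as an identity of joint laws. -/
theorem IsPoissonProcess.map_del_restrict_hull (hη : IsPoissonProcess η lam P)
    (hdel : IsGenerator del) (hB : IsLocalisingSeq R.sets B) (hlam : ∀ A ∈ R.sets, lam A < ∞)
    (h₁ : ∀ m, Tendsto (fun n => P {ω |
        restrict (del (restrict (η ω) (B n))) (B m) = restrict (del (η ω)) (B m) ∧
        restrict (η ω) (generatorHull del (restrict (η ω) (B n)) ∩ B m)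
          = restrict (η ω) (generatorHull del (η ω) ∩ B m)})
      atTop (𝓝 1))
    (h₂ : ∀ m, Tendsto (fun n => ∫⁻ ω, P.map η {μ |
        restrict μ (generatorHull del (η ω) ∩ B m)
          = restrict μ (generatorHull del (restrict (η ω) (B n)) ∩ B m)} ∂P)
      atTop (𝓝 1)) :
    P.map (fun ω => (del (η ω), restrict (η ω) (generatorHull del (η ω)))) =
      (P.prod (P.map η)).map fun p => (del (η p.1), restrict p.2 (generatorHull del (η p.1))) := by
  have := measurableEq (R := R)
  have hQ : IsProbabilityMeasure (P.map η) := hη.law.isProbabilityMeasure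
  have hBm : ∀ m, MeasurableSet (B m) := fun m => R.measurableSet _ (hB.mem m)
  have hηn : ∀ n, Measurable fun ω => restrict (η ω) (B n) := fun n =>
    (measurable_restrict (hBm n)).comp hη.measurable
  have hself : Measurable fun ω => (del (η ω), restrict (η ω) (generatorHull del (η ω))) :=
    hdel.measurable_del_restrict_hull_self.comp hη.measurable
  have hpair : Measurable fun p : Ω × pointMeasures R =>
      (del (η p.1), restrict p.2 (generatorHull del (η p.1))) :=
    hdel.measurable_del_restrict_hull.comp
      ((hη.measurable.comp measurable_fst).prodMk measurable_snd)
  have : IsProbabilityMeasure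
      (P.map fun ω => (del (η ω), restrict (η ω) (generatorHull del (η ω)))) :=
    Measure.isProbabilityMeasure_map hself.aemeasurable
  refine prod_ext_of_restrict hB fun m => ?_
  rw [Measure.map_map (measurable_prodMap_restrict (hBm m)) hself,
    Measure.map_map (measurable_prodMap_restrict (hBm m)) hpair]
  simp only [Function.comp_def, restrict_restrict _ (hBm m)]
  have hfst : ∀ (f : Ω → pointMeasures R), Measurable f →
      Measurable fun ω => restrict (del (f ω)) (B m) := fun f hf =>
    (measurable_restrict (hBm m)).comp (hdel.measurable.comp hf)
  have hsnd : ∀ (f : Ω → pointMeasures R), Measurable f →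
      Measurable fun p : Ω × pointMeasures R =>
        restrict p.2 (generatorHull del (f p.1) ∩ B m) := fun f hf => by
    simp only [← restrict_restrict _ (hBm m)]
    exact (measurable_restrict (hBm m)).comp (hdel.measurable_restrict_hull.comp
      ((hf.comp measurable_fst).prodMk measurable_snd))
  have hdiag : ∀ (f : Ω → pointMeasures R), Measurable f →
      Measurable fun ω => restrict (η ω) (generatorHull del (f ω) ∩ B m) := fun f hf => by
    have h := (hsnd f hf).comp (measurable_id.prodMk hη.measurable)
    exact h
  have hfst_n := fun n => hfst (fun ω => restrict (η ω) (B n)) (hηn n)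
  have hsnd_n := fun n => hsnd (fun ω => restrict (η ω) (B n)) (hηn n)
  have hdiag_n := fun n => hdiag (fun ω => restrict (η ω) (B n)) (hηn n)
  have hfst_lim := hfst η hη.measurable
  have hsnd_lim := hsnd η hη.measurable
  have hdiag_lim := hdiag η hη.measurable
  have hmeas₁ : ∀ n, MeasurableSet {ω |
      restrict (del (restrict (η ω) (B n))) (B m) = restrict (del (η ω)) (B m) ∧
      restrict (η ω) (generatorHull del (restrict (η ω) (B n)) ∩ B m)
        = restrict (η ω) (generatorHull del (η ω) ∩ B m)} := fun n =>
    (measurableSet_eq_fun (hfst_n n) hfst_lim).inter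
      (measurableSet_eq_fun (hdiag_n n) hdiag_lim)
  have hmeas₂ : ∀ n, MeasurableSet {p : Ω × pointMeasures R |
      restrict p.2 (generatorHull del (η p.1) ∩ B m)
        = restrict p.2 (generatorHull del (restrict (η p.1) (B n)) ∩ B m)} := fun n =>
    measurableSet_eq_fun hsnd_lim (hsnd_n n)
  have hc₁ := tendsto_measure_compl_of_tendsto_one hmeas₁ (h₁ m)
  have hc₂ := tendsto_measure_compl_of_tendsto_one (P := P.prod (P.map η)) hmeas₂ (by
    refine (h₂ m).congr fun n => ?_
    rw [Measure.prod_apply (hmeas₂ n)]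
    rfl)
  have hf : ∀ n, Measurable fun ω => (restrict (del (restrict (η ω) (B n))) (B m),
      restrict (η ω) (generatorHull del (restrict (η ω) (B n)) ∩ B m)) := fun n =>
    (hfst_n n).prodMk (hdiag_n n)
  have hf' : ∀ n, Measurable fun p : Ω × pointMeasures R =>
      (restrict (del (restrict (η p.1) (B n))) (B m),
        restrict p.2 (generatorHull del (restrict (η p.1) (B n)) ∩ B m)) := fun n => by
    have h := ((hfst_n n).comp measurable_fst).prodMk (hsnd_n n)
    exact h
  have hg : Measurable fun ω => (restrict (del (η ω)) (B m),
      restrict (η ω) (generatorHull del (η ω) ∩ B m)) :=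
    hfst_lim.prodMk hdiag_lim
  have hg' : Measurable fun p : Ω × pointMeasures R => (restrict (del (η p.1)) (B m),
      restrict p.2 (generatorHull del (η p.1) ∩ B m)) := by
    have h := (hfst_lim.comp measurable_fst).prodMk hsnd_lim
    exact h
  refine Measure.map_eq_of_tendsto_measure_ne hf hf' hg hg' ?_ ?_ ?_
  -- Only `n ≥ m` is covered, as `B m ⊆ B n` is needed; hence equality of laws is required only
  -- eventually.
  · filter_upwards [eventually_ge_atTop m] with n hn
    exact hη.map_del_restrict_hull_of_mem hdel hlam (hB.mem n) (hBm m) (hB.mono hn)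
  · refine hc₁.congr fun n => congrArg P ?_
    ext ω
    simp [Prod.ext_iff]
  -- For the independent copy, a discrepancy in the first coordinate is controlled by the first
  -- limit hypothesis and one in the second coordinate by the second.
  · have hfstP : ∀ S : Set Ω, MeasurableSet S → (P.prod (P.map η)) (Prod.fst ⁻¹' S) = P S :=
      fun S hS => measurePreserving_fst.measure_preimage hS.nullMeasurableSet
    have hsum := hc₁.add hc₂
    rw [add_zero] at hsum
    refine tendsto_of_tendsto_of_tendsto_of_le_of_le tendsto_const_nhds hsum
      (fun _ => zero_le) fun n => ?_
    simp only
    rw [← hfstP _ (hmeas₁ n).compl]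
    refine (measure_mono fun p hp => ?_).trans (measure_union_le _ _)
    by_contra hp'
    simp only [Set.mem_union, not_or, Set.mem_compl_iff, not_not, Set.mem_preimage] at hp'
    exact hp (Prod.ext hp'.1.1 hp'.2.symm)

end Markov

/-! ### From the identity of joint laws to the conditional distribution. -/

theorem proposition3p3 {X Ω : Type*} [MeasurableSpace X] [StandardBorelSpace X]
    [MeasurableSpace Ω] (P : Measure Ω) [IsProbabilityMeasure P]
    (R : LocalisingRing X) (B : ℕ → Set X) (hB : IsLocalisingSeq R.sets B)
    (lam : Measure X) (hlam : ∀ A ∈ R.sets, lam A < ∞)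
    (η : Ω → pointMeasures R) (hη : IsPoissonProcess η lam P)
    (del : pointMeasures R → pointMeasures R) (hdel : IsGenerator del)
    (h₁ : ∀ m, Tendsto (fun n => P {ω |
        PointMeasure.restrict (del (PointMeasure.restrict (η ω) (B n))) (B m)
          = PointMeasure.restrict (del (η ω)) (B m) ∧
        PointMeasure.restrict (η ω)
            (generatorHull del (PointMeasure.restrict (η ω) (B n)) ∩ B m)
          = PointMeasure.restrict (η ω) (generatorHull del (η ω) ∩ B m)})
      atTop (𝓝 1))
    (h₂ : ∀ m, Tendsto (fun n => ∫⁻ ω, poissonLaw R lam {μ |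
        PointMeasure.restrict μ (generatorHull del (η ω) ∩ B m)
          = PointMeasure.restrict μ
              (generatorHull del (PointMeasure.restrict (η ω) (B n)) ∩ B m)} ∂P)
      atTop (𝓝 1)) :
    ∀ A : Set (pointMeasures R), MeasurableSet A →
      P⟦{ω | PointMeasure.restrict (η ω) (generatorHull del (η ω)) ∈ A} |
          MeasurableSpace.comap (fun ω => del (η ω)) inferInstance⟧
        =ᵐ[P] fun ω => (poissonLaw R (lam.restrict (generatorHull del (η ω)))).real A := by
  intro A hA
  have := PointMeasure.measurableEq (R := R)
  have hQ : IsProbabilityMeasure (P.map η) := hη.law.isProbabilityMeasure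
  rw [hη.law.poissonLaw_eq hlam] at h₂
  have hjoint := hη.map_del_restrict_hull hdel hB hlam h₁ h₂
  have hδ : Measurable fun ω => del (η ω) := hdel.measurable.comp hη.measurable
  have hself : Measurable fun ω => PointMeasure.restrict (η ω) (generatorHull del (η ω)) :=
    (hdel.measurable_del_restrict_hull_self.comp hη.measurable).snd
  have hpair : Measurable fun p : Ω × pointMeasures R =>
      (del (η p.1), PointMeasure.restrict p.2 (generatorHull del (η p.1))) :=
    hdel.measurable_del_restrict_hull.comp
      ((hη.measurable.comp measurable_fst).prodMk measurable_snd)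
  -- The candidate conditional probability, written as a function of `μ` so that evaluation at `∂η`
  -- shows its measurability with respect to the conditioning σ-algebra.
  let φ : pointMeasures R → ℝ≥0∞ := fun μ =>
    P.map η {ψ | PointMeasure.restrict ψ (generatorHull del μ) ∈ A}
  have hφ : Measurable φ := measurable_measure_prodMk_left (hdel.measurable_restrict_hull hA)
  have hφ_top : ∀ μ, φ μ ≠ ∞ := fun μ => measure_ne_top _ _
  have hpoisson : (fun ω => (poissonLaw R (lam.restrict (generatorHull del (η ω)))).real A) =
      fun ω => (φ (del (η ω))).toReal := by
    funext ω
    have hS := hdel.measurableSet_hull (η ω)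
    rw [(hη.law.map_restrict hS).poissonLaw_eq
      fun D hD => (Measure.restrict_le_self D).trans_lt (hlam D hD), Measure.real,
      Measure.map_apply (PointMeasure.measurable_restrict hS) hA]
    simp only [φ, hdel.hull_del]
    rfl
  rw [hpoisson]
  have hAm : MeasurableSet {ω | PointMeasure.restrict (η ω) (generatorHull del (η ω)) ∈ A} :=
    hself hA
  have hφm : Measurable fun ω => φ (del (η ω)) := hφ.comp hδ
  have hφi : Integrable (fun ω => (φ (del (η ω))).toReal) P :=
    Integrable.of_bound hφm.ennreal_toReal.aestronglyMeasurable 1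
      (ae_of_all _ fun ω => by
        rw [Real.norm_of_nonneg ENNReal.toReal_nonneg]
        exact ENNReal.toReal_le_of_le_ofReal zero_le_one (by simpa [φ] using prob_le_one))
  refine (ae_eq_condExp_of_forall_setIntegral_eq hδ.comap_le
    ((integrable_const 1).indicator hAm) (fun s _ _ => hφi.integrableOn) ?_ ?_).symm
  · rintro _ ⟨C, hC, rfl⟩ -
    rw [integral_indicator hAm, integral_const, smul_eq_mul, mul_one, measureReal_restrict_apply_univ,
      measureReal_restrict_apply hAm, integral_toReal hφm.aemeasurable
        (ae_of_all _ fun ω => (hφ_top _).lt_top), Measure.real]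
    congr 1
    -- Testing the joint laws on `C ×ˢ A` gives the defining integral identity of the conditional
    -- expectation over the event `∂η ∈ C`.
    have h3 := congrArg (fun M => M (C ×ˢ A)) hjoint
    rw [Measure.map_apply (hδ.prodMk hself) (hC.prod hA), Measure.map_apply hpair (hC.prod hA),
      Measure.prod_apply (hpair (hC.prod hA))] at h3
    rw [← lintegral_indicator (hδ hC)]
    have hset : {ω | PointMeasure.restrict (η ω) (generatorHull del (η ω)) ∈ A} ∩
        (fun ω => del (η ω)) ⁻¹' C =
        (fun ω => (del (η ω), PointMeasure.restrict (η ω) (generatorHull del (η ω)))) ⁻¹' C ×ˢ A :=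
      Set.inter_comm _ _
    rw [hset, h3]
    refine lintegral_congr fun ω => ?_
    by_cases hω : del (η ω) ∈ C
    · rw [Set.indicator_of_mem (show ω ∈ (fun ω => del (η ω)) ⁻¹' C from hω)]
      refine congrArg (P.map η) (Set.ext fun ψ => ?_)
      simp [hω, hdel.hull_del]
    · rw [Set.indicator_of_notMem (show ω ∉ (fun ω => del (η ω)) ⁻¹' C from hω)]
      refine (measure_mono_null (fun ψ hψ => hω hψ.1) measure_empty).symm
  · exact ((hφ.comp (comap_measurable _)).ennreal_toReal).stronglyMeasurable.aestronglyMeasurable
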